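/- A linear equation of length $k$ is an equation $a_1x_1+\dots+a_kx_k=b$ with $a_1,\dots,a_k\in\mathbb Z\setminus\{0\}$ and $b\in\mathbb Z$ (so $b\neq 0$ is allowed); its underlying matrix is the $1\times k$ matrix $(a_1\ \cdots\ a_k)$. A $k$-distinct solution of the equation in a set $S\subseteq\mathbb Z$ is a solution $(x_1,\dots,x_k)\in S^k$ with $x_1,\dots,x_k$ pairwise distinct. The equation is irredundant if it has a $k$-distinct solution in the positive integers, and its underlying matrix is irredundant if the homogeneous equation $a_1x_1+\dots+a_kx_k=0$ has one. For linear equations $A,B$ of lengths $k_A,k_B$, a set $S\subseteq\mathbb Z$ is $(A,B)$-Rado if every colouring of the elements of $S$ with the colours red and blue yields a $k_A$-distinct solution of $A$ in $S$ all of whose entries are red, or a $k_B$-distinct solution of $B$ in $S$ all of whose entries are blue. Finally, $[n]_p$ denotes the random subset of $\{1,\dots,n\}$ that contains each element independently with probability $p$. Theorem. Let $k_B\geq k_A\geq 3$ be integers. Then there exists a constant $c>0$, depending only on $k_A$ and $k_B$, such that the following holds. Let $A$ and $B$ be linear equations of lengths $k_A$ and $k_B$ respectively such that $A$, $B$ and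 their underlying matrices are all irredundant, and let $p=p(n)\in[0,1]$. If $$p(n)\leq c\,n^{-\frac{k_Ak_B-k_A-k_B}{k_Ak_B-k_A}}$$ for all sufficiently large $n$, then $$\lim_{n\to\infty}\mathbb P\big[\,[n]_{p(n)}\text{ is }(A,B)\text{-Rado}\,\big]=0.$$ -/

import Mathlib

open Filter Topology ProbabilityTheory

/-- A linear equation `a₁ x₁ + ⋯ + aₖ xₖ = b` of length `k`, with integer coefficients, all of the
`aᵢ` being nonzero. It may be inhomogeneous (`b ≠ 0`). -/
structure LinearEquation (k : ℕ) where
  /-- The coefficients `a₁, …, aₖ`. -/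
  coeff : Fin k → ℤ
  /-- All coefficients are nonzero. -/
  coeff_ne_zero : ∀ i, coeff i ≠ 0
  /-- The right-hand side `b`. -/
  rhs : ℤ

namespace LinearEquation

/-- The underlying `1 × k` matrix `(a₁ ⋯ aₖ)` of a linear equation. -/
def underlyingMatrix {k : ℕ} (A : LinearEquation k) : Matrix (Fin 1) (Fin k) ℤ :=
  Matrix.of fun _ i => A.coeff i

/-- `x` is a `k`-distinct solution of `A`: it solves the equation and its entries are pairwise
distinct. -/
def IsDistinctSolution {k : ℕ} (A : LinearEquation k) (x : Fin k → ℤ) : Prop :=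
  ∑ i, A.coeff i * x i = A.rhs ∧ Function.Injective x

/-- `A` is irredundant: it has a `k`-distinct solution in the positive integers. -/
def Irredundant {k : ℕ} (A : LinearEquation k) : Prop :=
  ∃ x : Fin k → ℤ, (∀ i, 0 < x i) ∧ A.IsDistinctSolution x

end LinearEquation

/-- An integer matrix `M` with `k` columns is irredundant if `M x = 0` has a solution in the
positive integers with pairwise distinct entries. -/
def MatrixIrredundant {l k : ℕ} (M : Matrix (Fin l) (Fin k) ℤ) : Prop :=
  ∃ x : Fin k → ℤ, (∀ i, 0 < x i) ∧ Function.Injective x ∧ M.mulVec x = 0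

/-- The two colours. -/
inductive Colour
  | red
  | blue

/-- A set `S` of integers is `(A, B)`-Rado if every red/blue colouring of `S` has a red
`kA`-distinct solution of `A` in `S` or a blue `kB`-distinct solution of `B` in `S`. -/
def IsRado {kA kB : ℕ} (A : LinearEquation kA) (B : LinearEquation kB) (S : Set ℤ) : Prop :=
  ∀ χ : S → Colour,
    (∃ x : Fin kA → S, A.IsDistinctSolution (fun i => (x i : ℤ)) ∧ ∀ i, χ (x i) = .red) ∨
    (∃ y : Fin kB → S, B.IsDistinctSolution (fun i => (y i : ℤ)) ∧ ∀ i, χ (y i) = .blue)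

/-- The law of the binomial random set `[n]_p`: each element of `{1, …, n}` is included
independently with probability `p`, and no other integer is. -/
noncomputable def randomSubset (n : ℕ) (p : unitInterval) : MeasureTheory.Measure (Set ℤ) :=
  setBernoulli (Set.Icc (1 : ℤ) n) p

/-! The proof is a first moment argument over small or logarithmically long configurations that
every Rado set must contain. Write `a = kA`, `b = kB`, `β = b / (a (b - 1))` and `w = 1 / (b - 1)`.
The threshold is `p ≤ c n ^ (β - 1)`, so a new element contributes at most `c n ^ β` to an expected
count, while every solution containing a not yet determined element saves a factor `n`. Attaching
`N` elements that carry a chain of `k` solutions thus has exponent `β N - k`, called its weight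
below (`card_extensions_le`, `card_extensions_mul_pow_le`).

If `S` is Rado, its solutions of `A` and `B` form two hypergraphs whose vertices cannot be coloured
without a red edge of the first or a blue edge of the second. In a minimal such pair, every vertex
of an edge is the exact intersection of this edge with one of the other kind
(`IsMinimalUncolourable.isCrossing`). Hence one can explore: start with a solution of `A`, of weight
`a β - 1 = w`, and repeatedly attach at a marked vertex a crown, which is a solution of `B` together
with a solution of `A` through each of its `b - 1` other vertices. A full crown has `a (b - 1)` new
elements and `b` solutions, hence weight exactly `0`.

`IsCrossing.grow` shows that any crown which is not full costs at least `w`, or produces a set of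
negative weight. So at most one defect with total weight still nonnegative can occur: either the
total becomes negative, or there are at least `log₂ n` full crowns
(`IsCrossing.hasRareExploration`). A full crown hangs on a single vertex, so the number of ways to
attach it depends neither on `n` nor on the size of the structure built, once `n` has cancelled; a
small `c` makes each crown contribute a factor `1 / 2`. Long explorations then have expected number
at most `n ^ (w - 1)` up to logarithms, and those of negative weight a negative power of `n` up to
logarithms (`familyWeight_explorations_le`, `tendsto_randomSubset_isRado`).

For `a = b = 3` one has `β = w = 1 / 2` and the inequalities in `IsCrossing.grow` break down. There
single triples are attached instead of crowns, at two new elements and one solution per step, and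
the remaining tight configurations on four or six points are excluded by explicit colourings
(`hasRareExploration_of_triples`). -/

/-! ### Chains of hyperedges -/

section Chains

variable {α : Type*}

/-- `ChainRank E R X k` says that inside `X ⊇ R` there are `k` edges (sets satisfying `E`), listed
in such a way that each of them has a vertex outside of `R` and of all the preceding ones. -/
inductive ChainRank (E : Finset α → Prop) (R : Finset α) : Finset α → ℕ → Prop
  | zero {X : Finset α} : R ⊆ X → ChainRank E R X 0
  | succ {X X' g : Finset α} {k : ℕ} : ChainRank E R X k → X ⊆ X' → E g → g ⊆ X' → ¬ g ⊆ X →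
      ChainRank E R X' (k + 1)

namespace ChainRank

variable {E : Finset α → Prop} {R X Y g : Finset α} {k : ℕ}

lemma base_subset (h : ChainRank E R X k) : R ⊆ X := by
  induction h with
  | zero h => exact h
  | succ _ h _ _ _ ih => exact ih.trans h

lemma mono (h : ChainRank E R X k) (hXY : X ⊆ Y) : ChainRank E R Y k := by
  cases h with
  | zero h => exact .zero (h.trans hXY)
  | succ h h₁ h₂ h₃ h₄ => exact .succ h (h₁.trans hXY) h₂ (h₃.trans hXY) h₄

variable [DecidableEq α]

lemma add_edge (h : ChainRank E R X k) (hg : E g) (hgX : ¬ g ⊆ X) :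
    ChainRank E R (X ∪ g) (k + 1) :=
  .succ h Finset.subset_union_left hg Finset.subset_union_right hgX

/-- The last edge of a chain has a vertex whose removal only shortens the chain by one. -/
lemma exists_erase (h : ChainRank E R X (k + 1)) :
    ∃ t ∈ X, t ∉ R ∧ ChainRank E R (X.erase t) k ∧ ∃ g, E g ∧ t ∈ g ∧ g ⊆ X := by
  cases h with
  | succ h h₁ h₂ h₃ h₄ =>
    obtain ⟨t, htg, htX⟩ := Finset.not_subset.1 h₄
    exact ⟨t, h₃ htg, fun htR => htX (h.base_subset htR),
      h.mono fun x hx => Finset.mem_erase.2 ⟨fun hxt => htX (hxt ▸ hx), h₁ hx⟩, _, h₂, htg, h₃⟩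

lemma le_card_sdiff (h : ChainRank E R X k) : k ≤ (X \ R).card := by
  induction k generalizing X with
  | zero => exact Nat.zero_le _
  | succ k ih =>
    obtain ⟨t, htX, htR, h', -⟩ := h.exists_erase
    have := ih h'
    rw [Finset.erase_sdiff_comm, Finset.card_erase_of_mem (Finset.mem_sdiff.2 ⟨htX, htR⟩)] at this
    have : 0 < (X \ R).card := Finset.card_pos.2 ⟨t, Finset.mem_sdiff.2 ⟨htX, htR⟩⟩
    omega

/-- Edges `e x`, `x ∈ U`, each with a private vertex `x` outside of `R`, form a chain. -/
lemma biUnion {U : Finset α} {e : α → Finset α} (hE : ∀ x ∈ U, E (e x)) (hmem : ∀ x ∈ U, x ∈ e x)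
    (hR : ∀ x ∈ U, x ∉ R) (huniq : ∀ x ∈ U, ∀ x' ∈ U, x ∈ e x' → x = x') :
    ChainRank E R (R ∪ U.biUnion e) U.card := by
  induction U using Finset.induction_on with
  | empty => exact .zero (by simp)
  | insert x U hx ih =>
    rw [Finset.card_insert_of_notMem hx]
    have := ih (fun y hy => hE y (by simp [hy])) (fun y hy => hmem y (by simp [hy]))
      (fun y hy => hR y (by simp [hy]))
      (fun y hy z hz => huniq y (by simp [hy]) z (by simp [hz]))
    refine (this.add_edge (hE x (by simp)) fun hsub => ?_).mono ?_
    · have h1 := hsub (hmem x (by simp))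
      rw [Finset.mem_union, Finset.mem_biUnion] at h1
      rcases h1 with h1 | ⟨z, hz, hxz⟩
      · exact hR x (by simp) h1
      · exact hx ((huniq x (by simp) z (by simp [hz]) hxz) ▸ hz)
    · intro z; simp only [Finset.mem_union, Finset.mem_biUnion, Finset.mem_insert]; grind

end ChainRank

end Chains

/-! ### Growing a crown -/

section Crowns

variable {α : Type*} [DecidableEq α]

/-- Two uniform hypergraphs such that through every vertex of an edge of one of them there is an
edge of the other one which meets the first edge in this vertex only. -/
structure IsCrossing (a b : ℕ) (FA FB : Finset (Finset α)) : Prop where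
  card_left : ∀ e ∈ FA, e.card = a
  card_right : ∀ f ∈ FB, f.card = b
  cross_left : ∀ e ∈ FA, ∀ x ∈ e, ∃ f ∈ FB, e ∩ f = {x}
  cross_right : ∀ f ∈ FB, ∀ x ∈ f, ∃ e ∈ FA, e ∩ f = {x}

section ChainOfCrown

variable {E : Finset α → Prop} {R f f' U : Finset α} {e : α → Finset α} {x₀ y z : α}

/-- The edge `f` goes after the crown edges `e x` with `x ≠ x₀`. As these meet `f` only in `x`, the
vertex `x₀` is still new when `f` is added. -/
lemma chainRank_crown_erase (hf : E f) (hE : ∀ x ∈ U, E (e x)) (hUf : U ⊆ f)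
    (hUR : ∀ x ∈ U, x ∉ R) (he : ∀ x ∈ U, e x ∩ f = {x}) (hx₀ : x₀ ∈ U) :
    ChainRank E R (R ∪ (U.erase x₀).biUnion e ∪ f) U.card := by
  have hmem : ∀ x ∈ U, x ∈ e x := fun x hx =>
    (Finset.mem_inter.1 (by rw [he x hx]; simp : x ∈ e x ∩ f)).1
  have huniq : ∀ x ∈ U, ∀ x' ∈ U, x ∈ e x' → x = x' := fun x hx x' hx' h => by
    have : x ∈ e x' ∩ f := Finset.mem_inter.2 ⟨h, hUf hx⟩
    rw [he x' hx'] at this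
    exact Finset.mem_singleton.1 this
  have h1 : ChainRank E R (R ∪ (U.erase x₀).biUnion e) (U.erase x₀).card :=
    ChainRank.biUnion (fun x hx => hE x (Finset.mem_of_mem_erase hx))
      (fun x hx => hmem x (Finset.mem_of_mem_erase hx))
      (fun x hx => hUR x (Finset.mem_of_mem_erase hx))
      (fun x hx x' hx' => huniq x (Finset.mem_of_mem_erase hx) x' (Finset.mem_of_mem_erase hx'))
  have h2 := h1.add_edge hf fun hsub => by
    have h := hsub (hUf hx₀)
    rw [Finset.mem_union, Finset.mem_biUnion] at h
    rcases h with h | ⟨x, hx, hxx⟩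
    · exact hUR x₀ hx₀ h
    · exact (Finset.mem_erase.1 hx).1 (huniq x₀ hx₀ x (Finset.mem_of_mem_erase hx) hxx).symm
  rwa [Finset.card_erase_add_one hx₀] at h2

/-- A vertex `y` of `e x₀` seen nowhere else lets `e x₀` close the chain, so that all edges of the
crown count. -/
lemma chainRank_crown (hf : E f) (hE : ∀ x ∈ U, E (e x)) (hUf : U ⊆ f)
    (hUR : ∀ x ∈ U, x ∉ R) (he : ∀ x ∈ U, e x ∩ f = {x}) (hx₀ : x₀ ∈ U)
    (hy : y ∈ e x₀) (hy' : y ∉ R ∪ (U.erase x₀).biUnion e ∪ f) :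
    ChainRank E R (R ∪ (f ∪ U.biUnion e)) (U.card + 1) := by
  refine ((chainRank_crown_erase hf hE hUf hUR he hx₀).add_edge (hE x₀ hx₀)
    fun h => hy' (h hy)).mono fun t => ?_
  simp only [Finset.mem_union, Finset.mem_biUnion, Finset.mem_erase]
  grind

/-- The extra edge `f'` has to precede `e x₀`: it contributes `y`, and `e x₀` still contributes `z`,
which avoids `f'` because `e x₀ ∩ f' = {y}`. -/
lemma chainRank_crown_succ (hf : E f) (hE : ∀ x ∈ U, E (e x)) (hUf : U ⊆ f)
    (hUR : ∀ x ∈ U, x ∉ R) (he : ∀ x ∈ U, e x ∩ f = {x}) (hx₀ : x₀ ∈ U)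
    (hy' : y ∉ R ∪ (U.erase x₀).biUnion e ∪ f)
    (hz : z ∈ e x₀) (hz' : z ∉ R ∪ (U.erase x₀).biUnion e ∪ f) (hzy : z ≠ y)
    (hf' : E f') (hf'y : e x₀ ∩ f' = {y}) (hf'X : f' ⊆ R ∪ (f ∪ U.biUnion e)) :
    ChainRank E R (R ∪ (f ∪ U.biUnion e)) (U.card + 2) := by
  have hyf' : y ∈ e x₀ ∩ f' := by rw [hf'y]; simp
  rw [Finset.mem_inter] at hyf'
  refine (((chainRank_crown_erase hf hE hUf hUR he hx₀).add_edge hf'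
    fun h => hy' (h hyf'.2)).add_edge (hE x₀ hx₀) fun h => ?_).mono fun t => ?_
  · rcases Finset.mem_union.1 (h hz) with h | h
    · exact hz' h
    · have : z ∈ e x₀ ∩ f' := Finset.mem_inter.2 ⟨hz, h⟩
      rw [hf'y] at this
      exact hzy (Finset.mem_singleton.1 this)
  · have := @hf'X t
    simp only [Finset.mem_union, Finset.mem_biUnion, Finset.mem_erase] at this ⊢
    grind

end ChainOfCrown

/-- The possible outcomes of an attempt to enlarge `W` at its vertex `y` inside `V`. -/
theorem IsCrossing.grow {a b : ℕ} {FA FB : Finset (Finset α)} (hF : IsCrossing a b FA FB)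
    {E : Finset α → Prop} (hEA : ∀ e ∈ FA, E e) (hEB : ∀ f ∈ FB, E f)
    {V : Finset α} (hVA : ∀ e ∈ FA, e ⊆ V) (hVB : ∀ f ∈ FB, f ⊆ V)
    {β w : ℝ} (ha : 2 ≤ a) (hβw : a * β = 1 + w) (hbw : ((b : ℝ) - 1) * w = 1) (hw0 : 0 < w)
    (hw : w ≤ 1 / 3) (hβ : β ≤ 4 / 9) (hwβ : w ≤ β)
    {W f : Finset α} {y : α} (hf : f ∈ FB) (hyf : y ∈ f) (hyW : y ∈ W) (hfW : ¬ f ⊆ W) :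
    (∃ (T : Finset α) (k : ℕ), T ⊆ V ∧ T.card ≤ a * b ∧ ChainRank E ∅ T k ∧ β * T.card - k < 0) ∨
    (∃ (T : Finset α) (k : ℕ), T ⊆ V ∧ Disjoint W T ∧ T.card ≤ a * b ∧ ChainRank E W (W ∪ T) k ∧
      β * T.card - k < -w) ∨
    (∃ (T : Finset α) (y' : α), T ⊆ V ∧ Disjoint W T ∧ y' ∈ T ∧
      (∃ f' ∈ FB, y' ∈ f' ∧ ¬ f' ⊆ W ∪ T) ∧
      ((T.card = a * (b - 1) ∧ ChainRank E {y} ({y} ∪ T) b) ∨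
        (T.card ≤ a * b ∧ ∃ k : ℕ, ChainRank E W (W ∪ T) k ∧ β * T.card - k ≤ -w))) := by
  classical
  choose! e heA hef using hF.cross_right f hf
  set U := f \ W with hU
  have hUf : U ⊆ f := Finset.sdiff_subset
  have hUW : ∀ x ∈ U, x ∉ W := fun x hx => (Finset.mem_sdiff.1 hx).2
  have heE : ∀ x ∈ U, E (e x) := fun x hx => hEA _ (heA x (hUf hx))
  have heU : ∀ x ∈ U, e x ∩ f = {x} := fun x hx => hef x (hUf hx)
  have hmem : ∀ x ∈ U, x ∈ e x := fun x hx =>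
    (Finset.mem_inter.1 (by rw [heU x hx]; simp : x ∈ e x ∩ f)).1
  have hcard : ∀ x ∈ U, (e x).card = a := fun x hx => hF.card_left _ (heA x (hUf hx))
  have huniq : ∀ x ∈ U, ∀ x' ∈ U, x ∈ e x' → x = x' := fun x hx x' hx' h => by
    have : x ∈ e x' ∩ f := Finset.mem_inter.2 ⟨h, hUf hx⟩
    rw [heU x' hx'] at this
    exact Finset.mem_singleton.1 this
  have hUpos : 1 ≤ U.card := by
    rw [Nat.one_le_iff_ne_zero, ← Nat.pos_iff_ne_zero, Finset.card_pos]
    exact Finset.sdiff_nonempty.2 hfW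
  have hUcard : U.card + (f ∩ W).card = b := by
    rw [← hF.card_right f hf, hU, Finset.card_sdiff_add_card_inter]
  have hfWpos : 1 ≤ (f ∩ W).card := Finset.card_pos.2 ⟨y, Finset.mem_inter.2 ⟨hyf, hyW⟩⟩
  have hUr : (U.card : ℝ) ≤ b - 1 := by
    have : (U.card : ℝ) + 1 ≤ b := by exact_mod_cast (by omega : U.card + 1 ≤ b)
    linarith
  have hUr1 : (1 : ℝ) ≤ U.card := by exact_mod_cast hUpos
  have hUw : (U.card : ℝ) * w ≤ 1 := by nlinarith
  have hβ0 : 0 < β := hw0.trans_le hwβ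
  set T := (f ∪ U.biUnion e) \ W with hT
  have hTV : T ⊆ V := by
    refine Finset.sdiff_subset.trans (Finset.union_subset (hVB f hf) ?_)
    exact Finset.biUnion_subset.2 fun x hx => hVA _ (heA x (hUf hx))
  have hWT : Disjoint W T := Finset.disjoint_sdiff
  have hWTeq : W ∪ T = W ∪ (f ∪ U.biUnion e) := Finset.union_sdiff_self_eq_union
  have hTsub : T ⊆ U.biUnion (fun x => e x \ W) := by
    intro t ht
    rw [hT, Finset.mem_sdiff, Finset.mem_union] at ht
    obtain ⟨ht | ht, htW⟩ := ht
    · have htU : t ∈ U := Finset.mem_sdiff.2 ⟨ht, htW⟩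
      exact Finset.mem_biUnion.2 ⟨t, htU, Finset.mem_sdiff.2 ⟨hmem t htU, htW⟩⟩
    · obtain ⟨x, hx, htx⟩ := Finset.mem_biUnion.1 ht
      exact Finset.mem_biUnion.2 ⟨x, hx, Finset.mem_sdiff.2 ⟨htx, htW⟩⟩
  have hTle : T.card ≤ ∑ x ∈ U, (e x \ W).card :=
    (Finset.card_le_card hTsub).trans Finset.card_biUnion_le
  have hsumle : ∑ x ∈ U, (e x \ W).card ≤ U.card * a :=
    Finset.sum_le_card_nsmul _ _ _ fun x hx =>
      (Finset.card_le_card Finset.sdiff_subset).trans (hcard x hx).le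
  have hTab : T.card ≤ a * b := by
    calc T.card ≤ U.card * a := hTle.trans hsumle
      _ ≤ b * a := Nat.mul_le_mul_right _ (by omega)
      _ = a * b := mul_comm _ _
  have hTr : (T.card : ℝ) ≤ U.card * a := by exact_mod_cast hTle.trans hsumle
  by_cases hbad : ∀ x ∈ U, e x ⊆ W ∪ (U.erase x).biUnion e ∪ f
  · -- every vertex of a crown edge outside of `W` and `f` lies in two crown edges
    have hchain : ∀ R : Finset α, R ⊆ W → ChainRank E R (R ∪ U.biUnion e) U.card :=
      fun R hR => ChainRank.biUnion heE hmem (fun x hx h => hUW x hx (hR h)) huniq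
    set Y := U.biUnion e \ (W ∪ f) with hY
    have hTY : T.card = U.card + Y.card := by
      rw [← Finset.card_union_of_disjoint]
      · congr 1
        ext t
        have : t ∈ U ↔ t ∈ f ∧ t ∉ W := by rw [hU, Finset.mem_sdiff]
        simp only [hT, hY, Finset.mem_sdiff, Finset.mem_union]
        tauto
      · rw [Finset.disjoint_left]
        intro t ht htY
        exact (Finset.mem_sdiff.1 htY).2 (Finset.mem_union_right _ (hUf ht))
    have htwo : ∀ t ∈ Y, 2 ≤ (U.filter (fun x => t ∈ e x)).card := by
      intro t ht
      rw [hY, Finset.mem_sdiff, Finset.mem_biUnion] at ht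
      obtain ⟨⟨x, hx, htx⟩, hn⟩ := ht
      have h1 := hbad x hx htx
      have : t ∈ (U.erase x).biUnion e := by
        simp only [Finset.mem_union] at h1 hn
        tauto
      obtain ⟨x', hx', htx'⟩ := Finset.mem_biUnion.1 this
      have h2 : ({x, x'} : Finset α).card = 2 :=
        Finset.card_pair (Finset.ne_of_mem_erase hx').symm
      rw [← h2]
      refine Finset.card_le_card fun s hs => ?_
      simp only [Finset.mem_insert, Finset.mem_singleton] at hs
      rw [Finset.mem_filter]
      rcases hs with rfl | rfl
      · exact ⟨hx, htx⟩
      · exact ⟨Finset.mem_of_mem_erase hx', htx'⟩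
    have hcount : Y.card * 2 ≤ ∑ x ∈ U, (e x ∩ Y).card := by
      have h1 := Finset.sum_card_bipartiteAbove_eq_sum_card_bipartiteBelow (s := U) (t := Y)
        (fun x t => t ∈ e x)
      have h2 : ∑ x ∈ U, (e x ∩ Y).card
          = ∑ x ∈ U, (Finset.bipartiteAbove (fun x t => t ∈ e x) Y x).card := by
        refine Finset.sum_congr rfl fun x _ => ?_
        congr 1
        ext t
        simp [Finset.mem_bipartiteAbove, and_comm]
      rw [h2, h1]
      exact Finset.card_nsmul_le_sum _ _ _ htwo
    have hle1 : ∀ x ∈ U, (e x ∩ Y).card ≤ a - 1 := by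
      intro x hx
      rw [← hcard x hx, ← Finset.card_erase_of_mem (hmem x hx)]
      refine Finset.card_le_card fun t ht => ?_
      rw [Finset.mem_inter, hY, Finset.mem_sdiff] at ht
      refine Finset.mem_erase.2 ⟨?_, ht.1⟩
      rintro rfl
      exact ht.2.2 (Finset.mem_union_right _ (hUf hx))
    have hTr' : (T.card : ℝ) = U.card + Y.card := by exact_mod_cast hTY
    -- Double counting gives `2 |Y| ≤ |U| (a - 1)`, so the weight `β |T| - |U|` is at most `|U| (w +
    -- β - 1) / 2 < 0`. If the crown edges avoid `W`, they form a dense set by themselves.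
    by_cases hmeet : ∀ x ∈ U, Disjoint (e x) W
    · left
      have hTe : T = U.biUnion e := by
        ext t
        simp only [hT, Finset.mem_sdiff, Finset.mem_union]
        constructor
        · rintro ⟨h | h, htW⟩
          · have htU : t ∈ U := Finset.mem_sdiff.2 ⟨h, htW⟩
            exact Finset.mem_biUnion.2 ⟨t, htU, hmem t htU⟩
          · exact h
        · intro h
          refine ⟨Or.inr h, ?_⟩
          obtain ⟨x, hx, htx⟩ := Finset.mem_biUnion.1 h
          exact Finset.disjoint_left.1 (hmeet x hx) htx
      refine ⟨T, U.card, hTV, hTab, ?_, ?_⟩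
      · have := hchain ∅ (Finset.empty_subset _)
        rwa [Finset.empty_union, ← hTe] at this
      · have h1 : Y.card * 2 ≤ U.card * (a - 1) :=
          hcount.trans (Finset.sum_le_card_nsmul _ _ _ hle1)
        have h2 : (Y.card : ℝ) * 2 ≤ U.card * (a - 1) := by
          have : ((a - 1 : ℕ) : ℝ) = a - 1 := by push_cast [Nat.cast_sub (by omega : 1 ≤ a)]; ring
          rw [← this]; exact_mod_cast h1
        rw [hTr']
        nlinarith
    · right; left
      push Not at hmeet
      obtain ⟨x₁, hx₁, hx₁W⟩ := hmeet
      refine ⟨T, U.card, hTV, hWT, hTab, ?_, ?_⟩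
      · exact (hchain W subset_rfl).mono (by rw [hWTeq]; grind)
      · rw [hTr']
        -- A crown edge meeting `W` improves the double count by one, which pushes the weight below
        -- `-w` once `|U| ≥ 2`. For `|U| = 1` no vertex can lie in two crown edges, so `Y` is empty
        -- and the weight is `β - 1`.
        rcases Nat.lt_or_ge 1 U.card with hU2 | hU1
        · have hU2r : (2 : ℝ) ≤ U.card := by exact_mod_cast hU2
          have hlt : ∑ x ∈ U, (e x ∩ Y).card < ∑ _x ∈ U, (a - 1) := by
            refine Finset.sum_lt_sum hle1 ⟨x₁, hx₁, ?_⟩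
            obtain ⟨s, hs, hsW⟩ := Finset.not_disjoint_iff.1 hx₁W
            have hsx : s ∈ (e x₁).erase x₁ :=
              Finset.mem_erase.2 ⟨fun h => hUW x₁ hx₁ (h ▸ hsW), hs⟩
            rw [← hcard x₁ hx₁, ← Finset.card_erase_of_mem (hmem x₁ hx₁)]
            refine Finset.card_lt_card ⟨fun t ht => ?_, fun h => ?_⟩
            · rw [Finset.mem_inter, hY, Finset.mem_sdiff] at ht
              refine Finset.mem_erase.2 ⟨?_, ht.1⟩
              rintro rfl
              exact ht.2.2 (Finset.mem_union_right _ (hUf hx₁))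
            · have := (Finset.mem_inter.1 (h hsx)).2
              rw [hY, Finset.mem_sdiff] at this
              exact this.2 (Finset.mem_union_left _ hsW)
          rw [Finset.sum_const, smul_eq_mul] at hlt
          have h1 : Y.card * 2 + 1 ≤ U.card * (a - 1) := by omega
          have h2 : (Y.card : ℝ) * 2 + 1 ≤ U.card * (a - 1) := by
            have : ((a - 1 : ℕ) : ℝ) = a - 1 := by
              push_cast [Nat.cast_sub (by omega : 1 ≤ a)]; ring
            rw [← this]; exact_mod_cast h1
          nlinarith
        · have hUone : U.card = 1 := by omega
          have hY0 : Y.card = 0 := by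
            rw [Finset.card_eq_zero, Finset.eq_empty_iff_forall_notMem]
            intro t ht
            have := htwo t ht
            have := Finset.card_filter_le U (fun x => t ∈ e x)
            omega
          rw [hUone, hY0]
          push_cast
          linarith
  · right
    push Not at hbad
    obtain ⟨x₀, hx₀, hbad⟩ := hbad
    obtain ⟨y', hy'e, hy'⟩ := Finset.not_subset.1 hbad
    have hy'T : y' ∈ T := by
      rw [hT, Finset.mem_sdiff, Finset.mem_union, Finset.mem_biUnion]
      simp only [Finset.mem_union] at hy'
      exact ⟨Or.inr ⟨x₀, hx₀, hy'e⟩, by tauto⟩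
    have hrank : ChainRank E W (W ∪ T) (U.card + 1) := by
      rw [hWTeq]; exact chainRank_crown (hEB f hf) heE hUf hUW heU hx₀ hy'e hy'
    obtain ⟨f', hf', hf'y⟩ := hF.cross_left _ (heA x₀ (hUf hx₀)) y' hy'e
    -- If `y'` is the only new vertex of `e x₀`, then `|T| ≤ (|U| - 1) a + 2`, and the weight is at
    -- most `2 β - 1 - w < -w`.
    by_cases hone : ∃ z ∈ e x₀, z ∉ W ∪ (U.erase x₀).biUnion e ∪ f ∧ z ≠ y'
    · obtain ⟨z, hze, hz, hzy⟩ := hone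
      -- If the next edge `f'` is already covered, it is one more edge at no cost in vertices: the
      -- weight is at most `|U| w - 2 ≤ -1`.
      by_cases hf'sub : f' ⊆ W ∪ T
      · left
        refine ⟨T, U.card + 2, hTV, hWT, hTab, ?_, ?_⟩
        · rw [hWTeq] at hf'sub ⊢
          exact chainRank_crown_succ (hEB f hf) heE hUf hUW heU hx₀ hy' hze hz hzy (hEB f' hf')
            hf'y hf'sub
        · push_cast
          nlinarith
      · right
        refine ⟨T, y', hTV, hWT, hy'T, ⟨f', hf', ?_, hf'sub⟩, ?_⟩
        · exact (Finset.mem_inter.1 (by rw [hf'y]; simp : y' ∈ e x₀ ∩ f')).2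
        -- The weight is `β |T| - |U| - 1`. With `|U| ≤ b - 2` it is at most `(b - 2) w - 1 = -w`;
        -- with a vertex of `T` lost to an overlap it is at most `-β ≤ -w`. A full crown meets `W`
        -- in `y` only, so its chain can be based at `{y}`.
        by_cases hfull : U.card = b - 1 ∧ T.card = U.card * a
        · left
          obtain ⟨hfull1, hfull2⟩ := hfull
          refine ⟨by rw [hfull2, hfull1, mul_comm], ?_⟩
          have hdisj : ∀ x ∈ U, e x \ W = e x := by
            intro x hx
            refine Finset.eq_of_subset_of_card_le Finset.sdiff_subset ?_
            by_contra hlt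
            push Not at hlt
            have : ∑ x ∈ U, (e x \ W).card < ∑ _x ∈ U, a := by
              refine Finset.sum_lt_sum (fun x' hx' => ?_) ⟨x, hx, ?_⟩
              · exact (Finset.card_le_card Finset.sdiff_subset).trans (hcard x' hx').le
              · exact hlt.trans_le (hcard x hx).le
            rw [Finset.sum_const, smul_eq_mul] at this
            omega
          have hfWy : f ∩ W = {y} := by
            have h1 : (f ∩ W).card = 1 := by omega
            obtain ⟨s, hs⟩ := Finset.card_eq_one.1 h1
            have : y ∈ f ∩ W := Finset.mem_inter.2 ⟨hyf, hyW⟩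
            rw [hs, Finset.mem_singleton] at this
            rw [hs, this]
          have hbU : b = U.card + 1 := by omega
          have hsubT : {y} ∪ (f ∪ U.biUnion e) ⊆ {y} ∪ T := by
            intro t ht
            by_cases htW : t ∈ W
            · simp only [Finset.mem_union, Finset.mem_singleton, Finset.mem_biUnion] at ht ⊢
              rcases ht with ht | ht | ⟨x, hx, htx⟩
              · exact Or.inl ht
              · have : t ∈ f ∩ W := Finset.mem_inter.2 ⟨ht, htW⟩
                rw [hfWy, Finset.mem_singleton] at this
                exact Or.inl this
              · rw [← hdisj x hx] at htx
                exact absurd htW (Finset.mem_sdiff.1 htx).2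
            · rw [Finset.mem_union] at ht ⊢
              exact ht.imp id fun h => Finset.mem_sdiff.2 ⟨h, htW⟩
          rw [hbU]
          refine (chainRank_crown (hEB f hf) heE hUf (fun x hx h => ?_) heU hx₀ hy'e
            (fun h => hy' ?_)).mono hsubT
          · rw [Finset.mem_singleton] at h
            exact hUW x hx (h ▸ hyW)
          · refine Finset.union_subset_union_left (Finset.union_subset_union_left ?_) h
            exact Finset.singleton_subset_iff.2 hyW
        · right
          refine ⟨hTab, U.card + 1, hrank, ?_⟩
          push_cast
          rcases not_and_or.1 hfull with h | h
          · have h1 : (U.card : ℝ) ≤ b - 2 := by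
              have : (U.card : ℝ) + 2 ≤ b := by exact_mod_cast (by omega : U.card + 2 ≤ b)
              linarith
            nlinarith
          · have h1 : (T.card : ℝ) + 1 ≤ U.card * a := by
              exact_mod_cast (by omega : T.card + 1 ≤ U.card * a)
            nlinarith
    · left
      push Not at hone
      refine ⟨T, U.card + 1, hTV, hWT, hTab, hrank, ?_⟩
      have hsub : T ⊆ (U.erase x₀).biUnion e ∪ {x₀, y'} := by
        intro t ht
        have h1 := hTsub ht
        rw [Finset.mem_biUnion] at h1
        obtain ⟨x, hx, htx⟩ := h1
        rw [Finset.mem_sdiff] at htx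
        by_cases hxx : x = x₀
        · subst hxx
          by_cases hp : t ∈ W ∪ (U.erase x).biUnion e ∪ f
          · simp only [Finset.mem_union] at hp
            rcases hp with (hp | hp) | hp
            · exact absurd hp htx.2
            · exact Finset.mem_union_left _ hp
            · have : t ∈ e x ∩ f := Finset.mem_inter.2 ⟨htx.1, hp⟩
              rw [heU x hx, Finset.mem_singleton] at this
              simp [this]
          · simp [hone t htx.1 hp]
        · exact Finset.mem_union_left _
            (Finset.mem_biUnion.2 ⟨x, Finset.mem_erase.2 ⟨hxx, hx⟩, htx.1⟩)
      have hTc : T.card ≤ (U.card - 1) * a + 2 := by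
        refine (Finset.card_le_card hsub).trans ((Finset.card_union_le _ _).trans ?_)
        refine Nat.add_le_add ?_ Finset.card_le_two
        rw [← Finset.card_erase_of_mem hx₀]
        exact Finset.card_biUnion_le.trans (Finset.sum_le_card_nsmul _ _ _ fun x hx =>
          (hcard x (Finset.mem_of_mem_erase hx)).le)
      have hTcr : (T.card : ℝ) ≤ (U.card - 1) * a + 2 := by
        have : ((U.card - 1 : ℕ) : ℝ) = U.card - 1 := by
          push_cast [Nat.cast_sub hUpos]; ring
        rw [← this]; exact_mod_cast hTc
      push_cast
      nlinarith

end Crowns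

/-! ### Explorations -/

section Explorations

variable {α : Type*} [DecidableEq α]

lemma ChainRank.le_of_card_le {E : Finset α → Prop} {R T : Finset α} {k D : ℕ} (h : ChainRank E R (R ∪ T) k)
    (hT : T.card ≤ D) : k ≤ D := by
  refine h.le_card_sdiff.trans ((Finset.card_le_card fun x hx => ?_).trans hT)
  rw [Finset.mem_sdiff, Finset.mem_union] at hx
  tauto

open Classical in
/-- The `N`-element subsets `T` of `V` such that `R ∪ T` has a chain of `k` edges over `R`. -/
noncomputable def extensions (E : Finset α → Prop) (V R : Finset α) (N k : ℕ) :
    Finset (Finset α) :=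
  (V.powersetCard N).filter fun T => ChainRank E R (R ∪ T) k

lemma mem_extensions {E : Finset α → Prop} {V R T : Finset α} {N k : ℕ} :
    T ∈ extensions E V R N k ↔ T ⊆ V ∧ T.card = N ∧ ChainRank E R (R ∪ T) k := by
  simp only [extensions, Finset.mem_filter, Finset.mem_powersetCard, and_assoc]

/-- All the ways to enlarge a set `W` of a family, given together with a marked point, by an
extension attached anywhere to `W`, and to choose a new marked point. -/
noncomputable def globalStep (E : Finset α → Prop) (V : Finset α) (N k : ℕ)
    (𝓕 : Finset (Finset α × α)) : Finset (Finset α × α) :=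
  𝓕.biUnion fun s => ((extensions E V s.1 N k).filter (Disjoint s.1)).biUnion fun T =>
    (insert s.2 (s.1 ∪ T)).image fun y => (s.1 ∪ T, y)

/-- All the ways to enlarge a set `W` of a family, given together with a marked point `y`, by an
extension attached to `W` at `y` only, and to choose a new marked point in this extension. -/
noncomputable def localStep (E : Finset α → Prop) (V : Finset α) (N k : ℕ)
    (𝓕 : Finset (Finset α × α)) : Finset (Finset α × α) :=
  𝓕.biUnion fun s => ((extensions E V {s.2} N k).filter (Disjoint s.1)).biUnion fun T =>
    T.image fun y => (s.1 ∪ T, y)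

section Membership

variable {E : Finset α → Prop} {V S : Finset α} {k : ℕ} {𝓕 : Finset (Finset α × α)}

lemma mem_globalStep {s : Finset α × α} (hs : s ∈ 𝓕) {T : Finset α} {y : α} (hTV : T ⊆ V)
    (hd : Disjoint s.1 T) (hk : ChainRank E s.1 (s.1 ∪ T) k) (hy : y ∈ insert s.2 (s.1 ∪ T)) :
    (s.1 ∪ T, y) ∈ globalStep E V T.card k 𝓕 := by
  refine Finset.mem_biUnion.2 ⟨s, hs, Finset.mem_biUnion.2 ⟨T, ?_, Finset.mem_image_of_mem _ hy⟩⟩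
  exact Finset.mem_filter.2 ⟨mem_extensions.2 ⟨hTV, rfl, hk⟩, hd⟩

lemma mem_globalStep_zero {s : Finset α × α} (hs : s ∈ 𝓕) : s ∈ globalStep E V 0 0 𝓕 := by
  have := mem_globalStep (E := E) (V := V) (T := ∅) (k := 0) (y := s.2) hs
    (Finset.empty_subset _) (Finset.disjoint_empty_right _) (.zero (by simp)) (by simp)
  simpa using this

lemma mem_localStep {s : Finset α × α} (hs : s ∈ 𝓕) {T : Finset α} {y : α} (hTV : T ⊆ V)
    (hd : Disjoint s.1 T) (hk : ChainRank E {s.2} ({s.2} ∪ T) k) (hy : y ∈ T) :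
    (s.1 ∪ T, y) ∈ localStep E V T.card k 𝓕 := by
  refine Finset.mem_biUnion.2 ⟨s, hs, Finset.mem_biUnion.2 ⟨T, ?_, Finset.mem_image_of_mem _ hy⟩⟩
  exact Finset.mem_filter.2 ⟨mem_extensions.2 ⟨hTV, rfl, hk⟩, hd⟩

/-- Local steps can be iterated until a stopping condition holds. -/
lemma exists_iterate_localStep {N : ℕ} {Inv Halt : Finset α → α → Prop} (hSV : S ⊆ V)
    (hstep : ∀ W y, W ⊆ S → Inv W y → Halt W y ∨ ∃ (T : Finset α) (y' : α), T ⊆ S ∧ Disjoint W T ∧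
      y' ∈ T ∧ T.card = N ∧ ChainRank E {y} ({y} ∪ T) k ∧ Inv (W ∪ T) y')
    {s : Finset α × α} (hs : s ∈ 𝓕) (hsS : s.1 ⊆ S) (hsI : Inv s.1 s.2) (L : ℕ) :
    ∃ i ≤ L, ∃ s' ∈ (localStep E V N k)^[i] 𝓕, s'.1 ⊆ S ∧ (i = L ∨ Halt s'.1 s'.2) := by
  suffices h : (∃ i ≤ L, ∃ s' ∈ (localStep E V N k)^[i] 𝓕, s'.1 ⊆ S ∧ Halt s'.1 s'.2) ∨
      ∃ s' ∈ (localStep E V N k)^[L] 𝓕, s'.1 ⊆ S ∧ Inv s'.1 s'.2 by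
    rcases h with ⟨i, hi, s', h1, h2, h3⟩ | ⟨s', h1, h2, -⟩
    · exact ⟨i, hi, s', h1, h2, Or.inr h3⟩
    · exact ⟨L, le_rfl, s', h1, h2, Or.inl rfl⟩
  induction L with
  | zero => exact Or.inr ⟨s, hs, hsS, hsI⟩
  | succ L ih =>
    rcases ih with ⟨i, hi, h⟩ | ⟨s', h1, h2, h3⟩
    · exact Or.inl ⟨i, by omega, h⟩
    · rcases hstep _ _ h2 h3 with h | ⟨T, y', hTS, hd, hy', hc, hk, hI⟩
      · exact Or.inl ⟨L, by omega, s', h1, h2, h⟩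
      · refine Or.inr ⟨(s'.1 ∪ T, y'), ?_, Finset.union_subset h2 hTS, hI⟩
        rw [Function.iterate_succ_apply', ← hc]
        rw [← hc] at h1
        exact mem_localStep h1 (hTS.trans hSV) hd hk hy'

end Membership

variable [Inhabited α]

/-- Three global steps, separated by `i` and `j` local steps, starting from the empty set. -/
noncomputable def explorations (E : Finset α → Prop) (V : Finset α) (N₀ k₀ : ℕ)
    (N₁ k₁ i N₂ k₂ j N₃ k₃ : ℕ) : Finset (Finset α × α) :=
  globalStep E V N₃ k₃ ((localStep E V N₀ k₀)^[j] (globalStep E V N₂ k₂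
    ((localStep E V N₀ k₀)^[i] (globalStep E V N₁ k₁ {(∅, default)}))))

/-- `S` contains the outcome of an exploration which is either very dense, or very long. -/
def HasRareExploration (E : Finset α → Prop) (V : Finset α) (N₀ k₀ : ℕ) (β w : ℝ) (D L : ℕ)
    (S : Finset α) : Prop :=
  ∃ N₁ ≤ D, ∃ k₁ ≤ D, ∃ N₂ ≤ D, ∃ k₂ ≤ D, ∃ N₃ ≤ D, ∃ k₃ ≤ D, ∃ i ≤ L, ∃ j ≤ L,
    ((β * N₁ - k₁) + (β * N₂ - k₂) + (β * N₃ - k₃) < 0 ∨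
      ((β * N₁ - k₁) + (β * N₂ - k₂) + (β * N₃ - k₃) ≤ w ∧ L ≤ i + j)) ∧
    ∃ s ∈ explorations E V N₀ k₀ N₁ k₁ i N₂ k₂ j N₃ k₃, s.1 ⊆ S

section

variable {E : Finset α → Prop} {V S : Finset α} {N₀ k₀ D L : ℕ} {β w : ℝ}

lemma mem_globalStep_start {T : Finset α} {y : α} {k : ℕ} (hTV : T ⊆ V)
    (hk : ChainRank E ∅ T k) (hy : y ∈ T) :
    (T, y) ∈ globalStep E V T.card k {((∅ : Finset α), (default : α))} := by
  have := mem_globalStep (E := E) (V := V) (k := k) (y := y)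
    (s := ((∅ : Finset α), (default : α))) (Finset.mem_singleton_self _) hTV
    (Finset.disjoint_empty_left _) (by simpa using hk) (by simp [hy])
  simpa using this

/-- A small dense set is a rare exploration. -/
lemma hasRareExploration_of_dense {T : Finset α} {k : ℕ} (hTS : T ⊆ S) (hSV : S ⊆ V)
    (hTD : T.card ≤ D) (hk : ChainRank E ∅ T k) (hneg : β * T.card - k < 0) :
    HasRareExploration E V N₀ k₀ β w D L S := by
  have hkD : k ≤ D := ChainRank.le_of_card_le (R := ∅) (T := T) (by simpa using hk) hTD
  have hne : T.Nonempty := by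
    rw [Finset.nonempty_iff_ne_empty]
    rintro rfl
    have := hk.le_card_sdiff
    simp only [Finset.sdiff_self, Finset.card_empty, Nat.le_zero] at this
    simp [this] at hneg
  obtain ⟨y, hy⟩ := hne
  refine ⟨T.card, hTD, k, hkD, 0, Nat.zero_le _, 0, Nat.zero_le _, 0, Nat.zero_le _, 0,
    Nat.zero_le _, 0, Nat.zero_le _, 0, Nat.zero_le _, Or.inl (by simpa using hneg), (T, y),
    ?_, hTS⟩
  exact mem_globalStep_zero (mem_globalStep_zero (mem_globalStep_start (hTS.trans hSV) hk hy))

/-- The vertex set of a nonempty crossing pair has a rare exploration. -/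
theorem IsCrossing.hasRareExploration {a b : ℕ} {FA FB : Finset (Finset α)}
    (hF : IsCrossing a b FA FB) (hne : FA.Nonempty) (hEA : ∀ e ∈ FA, E e) (hEB : ∀ f ∈ FB, E f)
    (hVA : ∀ e ∈ FA, e ⊆ S) (hVB : ∀ f ∈ FB, f ⊆ S) (hSV : S ⊆ V)
    (ha : 2 ≤ a) (hb : 2 ≤ b)
    (hβw : a * β = 1 + w) (hbw : ((b : ℝ) - 1) * w = 1) (hw0 : 0 < w)
    (hw : w ≤ 1 / 3) (hβ : β ≤ 4 / 9) (hwβ : w ≤ β) :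
    HasRareExploration E V (a * (b - 1)) b β w (a * b) L S := by
  obtain ⟨e, he⟩ := hne
  have hecard := hF.card_left e he
  have haab : a ≤ a * b := Nat.le_mul_of_pos_right _ (by omega)
  obtain ⟨y, hy⟩ : e.Nonempty := Finset.card_pos.1 (by omega)
  obtain ⟨f, hf, hef⟩ := hF.cross_left e he y hy
  have hyf : y ∈ e ∩ f := by rw [hef]; simp
  rw [Finset.mem_inter] at hyf
  have hfe : ¬ f ⊆ e := fun h => by
    rw [Finset.inter_eq_right.2 h] at hef
    have := hF.card_right f hf
    rw [hef, Finset.card_singleton] at this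
    omega
  -- `Inv` says that a crown can be started at `y`; `Halt` collects every outcome of
  -- `IsCrossing.grow` other than a full crown.
  let Inv : Finset α → α → Prop := fun W y => y ∈ W ∧ ∃ f ∈ FB, y ∈ f ∧ ¬ f ⊆ W
  let Halt : Finset α → α → Prop := fun W _ =>
    (∃ (T : Finset α) (k : ℕ), T ⊆ S ∧ T.card ≤ a * b ∧ ChainRank E ∅ T k ∧ β * T.card - k < 0) ∨
    (∃ (T : Finset α) (k : ℕ), T ⊆ S ∧ Disjoint W T ∧ T.card ≤ a * b ∧ ChainRank E W (W ∪ T) k ∧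
      β * T.card - k < -w) ∨
    (∃ (T : Finset α) (k : ℕ) (y' : α), T ⊆ S ∧ Disjoint W T ∧ T.card ≤ a * b ∧
      ChainRank E W (W ∪ T) k ∧ β * T.card - k ≤ -w ∧ Inv (W ∪ T) y')
  have hstep : ∀ W y, W ⊆ S → Inv W y → Halt W y ∨ ∃ (T : Finset α) (y' : α), T ⊆ S ∧
      Disjoint W T ∧ y' ∈ T ∧ T.card = a * (b - 1) ∧ ChainRank E {y} ({y} ∪ T) b ∧
      Inv (W ∪ T) y' := by
    rintro W y - ⟨hyW, f, hf, hyf, hfW⟩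
    rcases hF.grow hEA hEB hVA hVB ha hβw hbw hw0 hw hβ hwβ hf hyf hyW hfW with
      h | h | ⟨T, y', hT, hd, hy', hf', ⟨hc, hk⟩ | ⟨hc, k, hk, hle⟩⟩
    · exact Or.inl (Or.inl h)
    · exact Or.inl (Or.inr (Or.inl h))
    · exact Or.inr ⟨T, y', hT, hd, hy', hc, hk, Finset.mem_union_right _ hy', hf'⟩
    · exact Or.inl (Or.inr (Or.inr
        ⟨T, k, y', hT, hd, hc, hk, hle, Finset.mem_union_right _ hy', hf'⟩))
  have hstart : (e, y) ∈ globalStep E V a 1 {((∅ : Finset α), (default : α))} := by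
    have hk : ChainRank E ∅ e 1 := by
      have := (ChainRank.zero (E := E) (Finset.Subset.refl ∅)).add_edge (hEA e he)
        (fun h => by rw [Finset.subset_empty.1 h] at hy; simp at hy)
      simpa using this
    have := mem_globalStep_start ((hVA e he).trans hSV) hk hy
    rwa [hecard] at this
  have hb1 : 1 ≤ a * b := Nat.mul_pos (by omega) (by omega)
  obtain ⟨i, hi, s, hs, hsS, hsi⟩ := exists_iterate_localStep hSV hstep hstart (hVA e he)
    ⟨hyf.1, f, hf, hyf.2, hfe⟩ L
  rcases hsi with rfl | h | ⟨T, k, hTS, hd, hTc, hk, hneg⟩ | ⟨T, k, y', hTS, hd, hTc, hk, hle, hI⟩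
  · refine ⟨a, haab, 1, hb1, 0, Nat.zero_le _, 0, Nat.zero_le _, 0, Nat.zero_le _, 0,
      Nat.zero_le _, i, le_rfl, 0, Nat.zero_le _, Or.inr ⟨?_, le_rfl⟩, s,
      mem_globalStep_zero (mem_globalStep_zero hs), hsS⟩
    push_cast
    linarith
  · obtain ⟨T, k, hTS, hTc, hk, hneg⟩ := h
    exact hasRareExploration_of_dense hTS hSV hTc hk hneg
  · refine ⟨a, haab, 1, hb1, T.card, hTc, k, hk.le_of_card_le hTc, 0, Nat.zero_le _, 0,
      Nat.zero_le _, i, hi, 0, Nat.zero_le _, Or.inl ?_, (s.1 ∪ T, s.2),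
      mem_globalStep_zero (mem_globalStep hs (hTS.trans hSV) hd hk (by simp)),
      Finset.union_subset hsS hTS⟩
    push_cast
    linarith
  -- After this first defect the total weight is at most `w - w = 0`, and full crowns are resumed
  -- from `y'`. A second defect makes the total at most `-w < 0`, which is why three global steps
  -- suffice.
  · have hs2 := mem_globalStep hs (hTS.trans hSV) hd hk (y := y') (by simp [hI.1])
    obtain ⟨j, hj, s', hs', hs'S, hs'j⟩ := exists_iterate_localStep hSV hstep hs2
      (Finset.union_subset hsS hTS) hI L
    rcases hs'j with rfl | h | h
    · refine ⟨a, haab, 1, hb1, T.card, hTc, k, hk.le_of_card_le hTc, 0, Nat.zero_le _, 0,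
        Nat.zero_le _, i, hi, j, le_rfl, Or.inr ⟨?_, by omega⟩, s',
        mem_globalStep_zero hs', hs'S⟩
      push_cast
      linarith
    · obtain ⟨T, k, hTS, hTc, hk, hneg⟩ := h
      exact hasRareExploration_of_dense hTS hSV hTc hk hneg
    · obtain ⟨T', k', hTS', hd', hTc', hk', hneg'⟩ : ∃ (T' : Finset α) (k' : ℕ), T' ⊆ S ∧
          Disjoint s'.1 T' ∧ T'.card ≤ a * b ∧ ChainRank E s'.1 (s'.1 ∪ T') k' ∧
          β * T'.card - k' ≤ -w := by
        rcases h with ⟨T, k, h1, h2, h3, h4, h5⟩ | ⟨T, k, y', h1, h2, h3, h4, h5, -⟩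
        · exact ⟨T, k, h1, h2, h3, h4, h5.le⟩
        · exact ⟨T, k, h1, h2, h3, h4, h5⟩
      refine ⟨a, haab, 1, hb1, T.card, hTc, k, hk.le_of_card_le hTc, T'.card, hTc', k',
        hk'.le_of_card_le hTc', i, hi, j, hj, Or.inl ?_, (s'.1 ∪ T', s'.2),
        mem_globalStep hs' (hTS'.trans hSV) hd' hk' (by simp),
        Finset.union_subset hs'S hTS'⟩
      push_cast
      linarith

end

end Explorations

/-! ### Minimal uncolourable pairs of hypergraphs -/

section Uncolourable

variable {α : Type*} [DecidableEq α]

/-- For every set `C` of red vertices there is a red edge in `FA` or a blue edge in `FB`. -/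
def IsUncolourable (FA FB : Finset (Finset α)) : Prop :=
  ∀ C : Finset α, (∃ e ∈ FA, e ⊆ C) ∨ ∃ f ∈ FB, Disjoint f C

/-- An uncolourable pair of hypergraphs from which no edge can be deleted. -/
structure IsMinimalUncolourable (FA FB : Finset (Finset α)) : Prop where
  uncolourable : IsUncolourable FA FB
  left_of_subset : ∀ G ⊆ FA, IsUncolourable G FB → G = FA
  right_of_subset : ∀ G ⊆ FB, IsUncolourable FA G → G = FB

lemma IsUncolourable.exists_minimal {FA FB : Finset (Finset α)} (h : IsUncolourable FA FB) :
    ∃ GA ⊆ FA, ∃ GB ⊆ FB, IsMinimalUncolourable GA GB := by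
  induction hn : FA.card + FB.card using Nat.strong_induction_on generalizing FA FB with
  | _ n ih =>
    by_cases h1 : ∃ G ⊆ FA, IsUncolourable G FB ∧ G ≠ FA
    · obtain ⟨G, hG, hu, hne⟩ := h1
      have hlt := Finset.card_lt_card (hG.ssubset_of_ne hne)
      obtain ⟨GA, hGA, GB, hGB, hm⟩ := ih _ (by omega) hu rfl
      exact ⟨GA, hGA.trans hG, GB, hGB, hm⟩
    by_cases h2 : ∃ G ⊆ FB, IsUncolourable FA G ∧ G ≠ FB
    · obtain ⟨G, hG, hu, hne⟩ := h2
      have hlt := Finset.card_lt_card (hG.ssubset_of_ne hne)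
      obtain ⟨GA, hGA, GB, hGB, hm⟩ := ih _ (by omega) hu rfl
      exact ⟨GA, hGA, GB, hGB.trans hG, hm⟩
    push Not at h1 h2
    exact ⟨FA, subset_rfl, FB, subset_rfl, h, h1, h2⟩

namespace IsMinimalUncolourable

variable {FA FB : Finset (Finset α)}

/-- By minimality some colouring is good for all edges except `e`, which is then entirely red.
Turning `x` blue destroys this red edge, so a blue edge must appear; it contains `x`, and no other
vertex of `e` is blue. The other direction swaps the colours. -/
lemma isCrossing (h : IsMinimalUncolourable FA FB) {a b : ℕ} (hA : ∀ e ∈ FA, e.card = a)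
    (hB : ∀ f ∈ FB, f.card = b) : IsCrossing a b FA FB := by
  refine ⟨hA, hB, fun e he x hx => ?_, fun f hf x hx => ?_⟩
  · have h1 : ¬ IsUncolourable (FA.erase e) FB := fun hu => by
      have := h.left_of_subset _ (Finset.erase_subset e FA) hu
      exact Finset.erase_eq_self.1 this he
    simp only [IsUncolourable, not_forall, not_or, not_exists, not_and] at h1
    obtain ⟨C, hCA, hCB⟩ := h1
    have heC : e ⊆ C := by
      rcases h.uncolourable C with ⟨e', he', hC⟩ | ⟨f, hf, hC⟩
      · by_cases hee : e' = e
        · exact hee ▸ hC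
        · exact absurd hC (hCA e' (Finset.mem_erase.2 ⟨hee, he'⟩))
      · exact absurd hC (hCB f hf)
    rcases h.uncolourable (C.erase x) with ⟨e', he', hC⟩ | ⟨f, hf, hC⟩
    · refine absurd (hC.trans (Finset.erase_subset x C)) (hCA e' (Finset.mem_erase.2 ⟨?_, he'⟩))
      rintro rfl
      exact Finset.notMem_erase x C (hC hx)
    · refine ⟨f, hf, ?_⟩
      have hfC := hCB f hf
      rw [Finset.not_disjoint_iff] at hfC
      rw [Finset.disjoint_left] at hC
      have hxf : x ∈ f := by
        obtain ⟨z, hzf, hzC⟩ := hfC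
        have := hC hzf
        rw [Finset.mem_erase] at this
        by_cases hzx : z = x
        · exact hzx ▸ hzf
        · exact absurd ⟨hzx, hzC⟩ this
      ext z
      simp only [Finset.mem_inter, Finset.mem_singleton]
      constructor
      · rintro ⟨hze, hzf⟩
        by_contra hzx
        exact hC hzf (Finset.mem_erase.2 ⟨hzx, heC hze⟩)
      · rintro rfl
        exact ⟨hx, hxf⟩
  · have h1 : ¬ IsUncolourable FA (FB.erase f) := fun hu => by
      have := h.right_of_subset _ (Finset.erase_subset f FB) hu
      exact Finset.erase_eq_self.1 this hf
    simp only [IsUncolourable, not_forall, not_or, not_exists, not_and] at h1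
    obtain ⟨C, hCA, hCB⟩ := h1
    have hfC : Disjoint f C := by
      rcases h.uncolourable C with ⟨e, he, hC⟩ | ⟨f', hf', hC⟩
      · exact absurd hC (hCA e he)
      · by_cases hff : f' = f
        · exact hff ▸ hC
        · exact absurd hC (hCB f' (Finset.mem_erase.2 ⟨hff, hf'⟩))
    rw [Finset.disjoint_left] at hfC
    rcases h.uncolourable (insert x C) with ⟨e, he, hC⟩ | ⟨f', hf', hC⟩
    · refine ⟨e, he, ?_⟩
      have hxe : x ∈ e := by
        by_contra hxe
        refine hCA e he fun z hz => ?_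
        rcases Finset.mem_insert.1 (hC hz) with rfl | hzC
        · exact absurd hz hxe
        · exact hzC
      ext z
      simp only [Finset.mem_inter, Finset.mem_singleton]
      constructor
      · rintro ⟨hze, hzf⟩
        rcases Finset.mem_insert.1 (hC hze) with rfl | hzC
        · rfl
        · exact absurd hzC (hfC hzf)
      · rintro rfl
        exact ⟨hxe, hx⟩
    · rw [Finset.disjoint_insert_right] at hC
      refine absurd hC.2 (hCB f' (Finset.mem_erase.2 ⟨?_, hf'⟩))
      rintro rfl
      exact hC.1 hx

lemma nonempty_left (h : IsMinimalUncolourable FA FB) (hB : ∀ f ∈ FB, f.Nonempty) :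
    FA.Nonempty := by
  rcases h.uncolourable (FB.biUnion id) with ⟨e, he, -⟩ | ⟨f, hf, hd⟩
  · exact ⟨e, he⟩
  · obtain ⟨x, hx⟩ := hB f hf
    exact absurd (Finset.mem_biUnion.2 ⟨f, hf, hx⟩) (Finset.disjoint_left.1 hd hx)

/-- A union of components which contains an edge is uncolourable itself. -/
lemma exists_mono_of_closed (h : IsMinimalUncolourable FA FB) {Z : Finset α}
    (hZ : ∀ g ∈ FA ∪ FB, ¬ Disjoint g Z → g ⊆ Z) (hin : ∃ g ∈ FA ∪ FB, g ⊆ Z) (C : Finset α) :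
    ∃ g ∈ FA ∪ FB, g ⊆ Z ∧ (g ⊆ C ∨ Disjoint g C) := by
  by_contra hcon
  push Not at hcon
  -- The edges not inside `Z` have a good colouring: otherwise an edge inside `Z` could be deleted,
  -- against minimality.
  have hout : ∃ C' : Finset α, (∀ e ∈ FA, ¬ e ⊆ Z → ¬ e ⊆ C') ∧
      ∀ f ∈ FB, ¬ f ⊆ Z → ¬ Disjoint f C' := by
    by_contra hno
    push Not at hno
    obtain ⟨g, hg, hgZ⟩ := hin
    rcases Finset.mem_union.1 hg with hg | hg
    · have hu : IsUncolourable (FA.erase g) FB := fun C' => by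
        by_cases hC : ∀ e ∈ FA, ¬ e ⊆ Z → ¬ e ⊆ C'
        · obtain ⟨f, hf, -, hd⟩ := hno C' hC
          exact Or.inr ⟨f, hf, hd⟩
        · push Not at hC
          obtain ⟨e, he, heZ, heC⟩ := hC
          exact Or.inl ⟨e, Finset.mem_erase.2 ⟨fun h => heZ (h ▸ hgZ), he⟩, heC⟩
      have := h.left_of_subset _ (Finset.erase_subset g FA) hu
      exact Finset.erase_eq_self.1 this hg
    · have hu : IsUncolourable FA (FB.erase g) := fun C' => by
        by_cases hC : ∀ e ∈ FA, ¬ e ⊆ Z → ¬ e ⊆ C'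
        · obtain ⟨f, hf, hfZ, hd⟩ := hno C' hC
          exact Or.inr ⟨f, Finset.mem_erase.2 ⟨fun h => hfZ (h ▸ hgZ), hf⟩, hd⟩
        · push Not at hC
          obtain ⟨e, he, heZ, heC⟩ := hC
          exact Or.inl ⟨e, he, heC⟩
      have := h.right_of_subset _ (Finset.erase_subset g FB) hu
      exact Finset.erase_eq_self.1 this hg
  obtain ⟨C', hC'A, hC'B⟩ := hout
  have hdisj : ∀ g ∈ FA ∪ FB, ¬ g ⊆ Z → ∀ z ∈ g, z ∉ Z := fun g hg hgZ z hz hzZ =>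
    hgZ (hZ g hg (Finset.not_disjoint_iff.2 ⟨z, hz, hzZ⟩))
  -- No edge straddles the boundary of `Z`, so the two colourings can be glued.
  rcases h.uncolourable (C ∩ Z ∪ C' \ Z) with ⟨e, he, hC⟩ | ⟨f, hf, hC⟩
  · have heG : e ∈ FA ∪ FB := Finset.mem_union_left _ he
    by_cases heZ : e ⊆ Z
    · refine (hcon e heG heZ).1 fun z hz => ?_
      have := hC hz
      simp only [Finset.mem_union, Finset.mem_inter, Finset.mem_sdiff] at this
      have := heZ hz
      tauto
    · refine hC'A e he heZ fun z hz => ?_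
      have := hC hz
      simp only [Finset.mem_union, Finset.mem_inter, Finset.mem_sdiff] at this
      have := hdisj e heG heZ z hz
      tauto
  · have hfG : f ∈ FA ∪ FB := Finset.mem_union_right _ hf
    rw [Finset.disjoint_left] at hC
    by_cases hfZ : f ⊆ Z
    · refine (hcon f hfG hfZ).2 (Finset.disjoint_left.2 fun z hz hzC => hC hz ?_)
      exact Finset.mem_union_left _ (Finset.mem_inter.2 ⟨hzC, hfZ hz⟩)
    · refine hC'B f hf hfZ (Finset.disjoint_left.2 fun z hz hzC => hC hz ?_)
      exact Finset.mem_union_right _ (Finset.mem_sdiff.2 ⟨hzC, hdisj f hfG hfZ z hz⟩)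

end IsMinimalUncolourable

end Uncolourable

/-! ### Pairs of triple systems -/

section Triples

variable {α : Type*} [DecidableEq α] {E : Finset α → Prop} {G : Finset (Finset α)}

/-- The edge `h` comes first and contributes `t`; then `g` contributes `u`, which is not in `h`. For
triples this yields two edges on two new points, of weight `-1`. -/
lemma chainRank_two_of_inter {W g h : Finset α} {t u : α} (hg : E g) (hh : E h) (ht : t ∉ W)
    (hu : u ∈ g) (huW : u ∉ W) (hut : u ≠ t) (hgh : g ∩ h = {t}) (hsub : h ⊆ W ∪ g) :
    ChainRank E W (W ∪ g) 2 := by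
  have hth : t ∈ g ∩ h := by rw [hgh]; simp
  rw [Finset.mem_inter] at hth
  have h1 : ChainRank E W (W ∪ h) 1 :=
    (ChainRank.zero (E := E) (Finset.Subset.refl W)).add_edge hh fun h => ht (h hth.2)
  refine (h1.add_edge hg fun h => ?_).mono ?_
  · rcases Finset.mem_union.1 (h hu) with h | h
    · exact huW h
    · have := Finset.mem_inter.2 ⟨hu, h⟩
      rw [hgh] at this
      exact hut (Finset.mem_singleton.1 this)
  · exact Finset.union_subset (Finset.union_subset Finset.subset_union_left hsub)
      Finset.subset_union_right

lemma sdiff_card_of_card_eq_three {W g : Finset α} {y : α} (hg : g.card = 3) (hyg : y ∈ g)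
    (hyW : y ∈ W) :
    (g \ W).card ≤ 1 ∨ ∃ t u, t ∉ W ∧ u ∉ W ∧ t ≠ u ∧ y ≠ t ∧ y ≠ u ∧ g = {y, t, u} ∧
      g \ W = {t, u} := by
  have hsub : g \ W ⊆ g.erase y := fun z hz => by
    rw [Finset.mem_sdiff] at hz
    exact Finset.mem_erase.2 ⟨fun h => hz.2 (h ▸ hyW), hz.1⟩
  have hc : (g.erase y).card = 2 := by rw [Finset.card_erase_of_mem hyg, hg]
  rcases Nat.lt_or_ge 1 (g \ W).card with h | h
  · right
    have heq := Finset.eq_of_subset_of_card_le hsub (by omega)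
    obtain ⟨t, u, htu, hE⟩ := Finset.card_eq_two.1 hc
    have hg' : g = {y, t, u} := by rw [← hE, Finset.insert_erase hyg]
    have ht : t ∈ g \ W := by rw [heq, hE]; simp
    have hu : u ∈ g \ W := by rw [heq, hE]; simp
    rw [Finset.mem_sdiff] at ht hu
    exact ⟨t, u, ht.2, hu.2, htu, fun h => ht.2 (h ▸ hyW), fun h => hu.2 (h ▸ hyW), hg',
      heq.trans hE⟩
  · exact Or.inl h

lemma chainRank_one_triple {y t u : α} (ht : y ≠ t) (hg : E {y, t, u}) :
    ChainRank E {y} ({y} ∪ {t, u}) 1 :=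
  .succ (.zero (Finset.Subset.refl {y})) Finset.subset_union_left hg
    (fun x hx => by simpa [or_left_comm] using hx)
    (fun h => ht (Finset.mem_singleton.1 (h (by simp : t ∈ ({y, t, u} : Finset α)))).symm)

variable {V S : Finset α}

/-- Local steps attached to a set of nonpositive weight. -/
lemma exists_localStep_of_open (hcard : ∀ g ∈ G, g.card = 3)
    (hcross : ∀ g ∈ G, ∀ x ∈ g, ∃ h ∈ G, g ∩ h = {x}) (hE : ∀ g ∈ G, E g) (hGS : ∀ g ∈ G, g ⊆ S)
    (hSV : S ⊆ V) {𝓕 : Finset (Finset α × α)} {s : Finset α × α} (hs : s ∈ 𝓕) (hsS : s.1 ⊆ S)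
    {g : Finset α} (hg : g ∈ G) (hsg : s.2 ∈ g) (hs2 : s.2 ∈ s.1) (hgs : ¬ g ⊆ s.1) (L : ℕ) :
    ∃ i ≤ L, ∃ s' ∈ (localStep E V 2 1)^[i] 𝓕, s'.1 ⊆ S ∧ (i = L ∨
      ∃ (T : Finset α) (k : ℕ), T ⊆ S ∧ Disjoint s'.1 T ∧ T.card ≤ 2 ∧
        ChainRank E s'.1 (s'.1 ∪ T) k ∧ (1 / 2 : ℝ) * T.card - k < 0) := by
  refine exists_iterate_localStep (Halt := fun W _ => ∃ (T : Finset α) (k : ℕ), T ⊆ S ∧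
    Disjoint W T ∧ T.card ≤ 2 ∧ ChainRank E W (W ∪ T) k ∧ (1 / 2 : ℝ) * T.card - k < 0)
    (Inv := fun W y => y ∈ W ∧ ∃ g ∈ G, y ∈ g ∧ ¬ g ⊆ W) hSV ?_ hs hsS ⟨hs2, g, hg, hsg, hgs⟩ L
  rintro W y - ⟨hyW, g, hg, hyg, hgW⟩
  have hTS : g \ W ⊆ S := Finset.sdiff_subset.trans (hGS g hg)
  have hWT : Disjoint W (g \ W) := Finset.disjoint_sdiff
  have hWg : W ∪ g \ W = W ∪ g := Finset.union_sdiff_self_eq_union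
  rcases sdiff_card_of_card_eq_three (hcard g hg) hyg hyW with
    h1 | ⟨t, u, htW, huW, htu, hyt, hyu, hgeq, hgW'⟩
  · refine Or.inl ⟨g \ W, 1, hTS, hWT, by omega, ?_, ?_⟩
    · rw [hWg]
      exact (ChainRank.zero (E := E) (Finset.Subset.refl W)).add_edge (hE g hg) hgW
    · have : ((g \ W).card : ℝ) ≤ 1 := by exact_mod_cast h1
      push_cast
      linarith
  · have hc2 : (g \ W).card = 2 := by rw [hgW', Finset.card_pair htu]
    obtain ⟨h, hh, hgh⟩ := hcross g hg t (by rw [hgeq]; simp)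
    have hth : t ∈ g ∩ h := by rw [hgh]; simp
    rw [Finset.mem_inter] at hth
    -- A triple with two new points has weight `0`. Either the triple `h` through its new point `t`
    -- is already covered, which makes the weight negative, or the exploration continues with `h`.
    by_cases hsub : h ⊆ W ∪ g
    · refine Or.inl ⟨g \ W, 2, hTS, hWT, hc2.le, ?_, ?_⟩
      · rw [hWg]
        exact chainRank_two_of_inter (hE g hg) (hE h hh) htW (u := u) (by rw [hgeq]; simp) huW
          htu.symm hgh hsub
      · rw [hc2]; norm_num
    · refine Or.inr ⟨g \ W, t, hTS, hWT, by rw [hgW']; simp, hc2, ?_, ?_⟩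
      · rw [hgW']
        exact chainRank_one_triple hyt (hgeq ▸ hE g hg)
      · rw [hWg]
        exact ⟨Finset.mem_union_right _ hth.1, h, hh, hth.2, hsub⟩

variable [Inhabited α] {D L : ℕ}

/-- In a rare exploration of triples one may start from a small set of nonpositive weight. -/
lemma hasRareExploration_of_open (hcard : ∀ g ∈ G, g.card = 3)
    (hcross : ∀ g ∈ G, ∀ x ∈ g, ∃ h ∈ G, g ∩ h = {x}) (hE : ∀ g ∈ G, E g) (hGS : ∀ g ∈ G, g ⊆ S)
    (hSV : S ⊆ V) (hD : 2 ≤ D) {Z : Finset α} {k : ℕ} (hZS : Z ⊆ S) (hZD : Z.card ≤ D)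
    (hk : ChainRank E ∅ Z k) (hZk : Z.card ≤ 2 * k)
    {g : Finset α} (hg : g ∈ G) (hgZ : ¬ g ⊆ Z) (hgZ' : ¬ Disjoint g Z) :
    HasRareExploration E V 2 1 (1 / 2) (1 / 2) D L S := by
  obtain ⟨y, hyg, hyZ⟩ := Finset.not_disjoint_iff.1 hgZ'
  have hkD : k ≤ D := ChainRank.le_of_card_le (R := ∅) (T := Z) (by simpa using hk) hZD
  have hZr : (Z.card : ℝ) ≤ 2 * k := by exact_mod_cast hZk
  obtain ⟨i, hi, s, hs, hsS, rfl | ⟨T, k', hTS, hd, hT2, hk', hneg⟩⟩ :=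
    exists_localStep_of_open hcard hcross hE hGS hSV
      (mem_globalStep_start (hZS.trans hSV) hk hyZ) hZS hg hyg hyZ hgZ L
  · refine ⟨Z.card, hZD, k, hkD, 0, Nat.zero_le _, 0, Nat.zero_le _, 0, Nat.zero_le _, 0,
      Nat.zero_le _, i, le_rfl, 0, Nat.zero_le _, Or.inr ⟨?_, le_rfl⟩, s,
      mem_globalStep_zero (mem_globalStep_zero hs), hsS⟩
    push_cast
    linarith
  · refine ⟨Z.card, hZD, k, hkD, T.card, hT2.trans hD, k', hk'.le_of_card_le (hT2.trans hD), 0,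
      Nat.zero_le _, 0, Nat.zero_le _, i, hi, 0, Nat.zero_le _, Or.inl ?_, (s.1 ∪ T, s.2),
      mem_globalStep_zero (mem_globalStep hs (hTS.trans hSV) hd hk' (by simp)),
      Finset.union_subset hsS hTS⟩
    push_cast
    linarith

/-- The union of three triples which pairwise meet in distinct points cannot span
a component, unless there is a rare exploration. -/
lemma hasRareExploration_of_triangle (hcard : ∀ g ∈ G, g.card = 3)
    (hcross : ∀ g ∈ G, ∀ x ∈ g, ∃ h ∈ G, g ∩ h = {x}) (hE : ∀ g ∈ G, E g) (hGS : ∀ g ∈ G, g ⊆ S)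
    (hcol : ∀ Z : Finset α, (∀ g ∈ G, ¬ Disjoint g Z → g ⊆ Z) → (∃ g ∈ G, g ⊆ Z) →
      ∀ C : Finset α, ∃ g ∈ G, g ⊆ Z ∧ (g ⊆ C ∨ Disjoint g C))
    (hSV : S ⊆ V) (hD : 6 ≤ D) {e f₁ f₂ : Finset α} (he : e ∈ G) (hf₁ : f₁ ∈ G) (hf₂ : f₂ ∈ G)
    {x y₁ y₂ z : α} (hx : x ∈ e) (hxy₁ : x ≠ y₁) (hxy₂ : x ≠ y₂) (hy : y₁ ≠ y₂)
    (h₁ : e ∩ f₁ = {y₁}) (h₂ : e ∩ f₂ = {y₂}) (hz₁ : z ∈ f₁) (hz₂ : z ∈ f₂) :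
    HasRareExploration E V 2 1 (1 / 2) (1 / 2) D L S := by
  by_contra hcon
  -- Without a rare exploration, a small set of nonpositive weight has weight `0` and is a union of
  -- components, hence is uncolourable itself by `hcol`.
  have hclosed : ∀ Z : Finset α, Z ⊆ S → Z.card ≤ 6 → ∀ k : ℕ, ChainRank E ∅ Z k →
      Z.card ≤ 2 * k → Z.card = 2 * k ∧ ∀ g ∈ G, ¬ Disjoint g Z → g ⊆ Z := by
    intro Z hZS hZ6 k hk hZk
    refine ⟨le_antisymm hZk ?_, fun g hg hgZ => ?_⟩
    · by_contra hlt
      refine hcon (hasRareExploration_of_dense hZS hSV (hZ6.trans hD) hk ?_)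
      have : (Z.card : ℝ) < 2 * k := by exact_mod_cast (by omega : Z.card < 2 * k)
      linarith
    · by_contra hsub
      exact hcon (hasRareExploration_of_open hcard hcross hE hGS hSV (by omega) hZS
        (hZ6.trans hD) hk hZk hg hsub hgZ)
  have hy₁ : y₁ ∈ e ∩ f₁ := by rw [h₁]; simp
  have hy₂ : y₂ ∈ e ∩ f₂ := by rw [h₂]; simp
  rw [Finset.mem_inter] at hy₁ hy₂
  have hf₁e : ∀ t ∈ e, t ∈ f₁ → t = y₁ := fun t ht ht' => by
    have : t ∈ e ∩ f₁ := Finset.mem_inter.2 ⟨ht, ht'⟩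
    rwa [h₁, Finset.mem_singleton] at this
  have hf₂e : ∀ t ∈ e, t ∈ f₂ → t = y₂ := fun t ht ht' => by
    have : t ∈ e ∩ f₂ := Finset.mem_inter.2 ⟨ht, ht'⟩
    rwa [h₂, Finset.mem_singleton] at this
  have hfirst : ∀ g ∈ G, ChainRank E ∅ g 1 := fun g hg => by
    have := (ChainRank.zero (E := E) (Finset.Subset.refl ∅)).add_edge (hE g hg)
      (fun h => by
        have := hcard g hg
        rw [Finset.subset_empty.1 h] at this
        simp at this)
    simpa using this
  -- two triples share at most one point
  have hlin : ∀ g ∈ G, ∀ h ∈ G, ∀ p q, p ≠ q → p ∈ g → q ∈ g → p ∈ h → q ∈ h → g = h := by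
    intro g hg h hh p q hpq hpg hqg hph hqh
    by_contra hgh
    have hsub : ¬ h ⊆ g := fun hs =>
      hgh (Finset.eq_of_subset_of_card_le hs (by rw [hcard g hg, hcard h hh])).symm
    have hi : 2 ≤ (g ∩ h).card := by
      rw [← Finset.card_pair hpq]
      refine Finset.card_le_card fun t ht => ?_
      simp only [Finset.mem_insert, Finset.mem_singleton] at ht
      rcases ht with rfl | rfl <;> simp [*]
    have hu := Finset.card_union_add_card_inter g h
    rw [hcard g hg, hcard h hh] at hu
    obtain ⟨hZ4, hZ⟩ := hclosed (g ∪ h) (Finset.union_subset (hGS g hg) (hGS h hh)) (by omega) 2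
      ((hfirst g hg).add_edge (hE h hh) hsub) (by omega)
    -- Two triples with two common points span four points, and colouring two of these red and two
    -- blue leaves no monochromatic triple.
    obtain ⟨C, hCZ, hC⟩ := Finset.exists_subset_card_eq (s := g ∪ h) (n := 2) (by omega)
    obtain ⟨g', hg', hg'Z, hg'C⟩ := hcol _ hZ ⟨g, hg, Finset.subset_union_left⟩ C
    have h3 := hcard g' hg'
    rcases hg'C with hs | hd
    · have := Finset.card_le_card hs
      omega
    · have h4 := Finset.card_le_card (Finset.union_subset hg'Z hCZ)
      rw [Finset.card_union_of_disjoint hd] at h4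
      omega
  have hxf₁ : x ∉ f₁ := fun h => hxy₁ (hf₁e x hx h)
  have hxf₂ : x ∉ f₂ := fun h => hxy₂ (hf₂e x hx h)
  have hy₂f₁ : y₂ ∉ f₁ := fun h => hy (hf₁e y₂ hy₂.1 h).symm
  have hrank : ChainRank E ∅ (f₁ ∪ f₂ ∪ e) 3 := by
    refine ((hfirst f₁ hf₁).add_edge (hE f₂ hf₂) fun h => hy₂f₁ (h hy₂.2)).add_edge (hE e he)
      fun h => ?_
    rcases Finset.mem_union.1 (h hx) with h | h
    · exact hxf₁ h
    · exact hxf₂ h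
  have hecard := hcard e he
  have hee : e = {x, y₁, y₂} := by
    symm
    refine Finset.eq_of_subset_of_card_le (fun t ht => ?_) ?_
    · simp only [Finset.mem_insert, Finset.mem_singleton] at ht
      rcases ht with rfl | rfl | rfl
      exacts [hx, hy₁.1, hy₂.1]
    · rw [hecard, Finset.card_eq_three.2 ⟨x, y₁, y₂, hxy₁, hxy₂, hy, rfl⟩]
  have hZcard : (f₁ ∪ f₂ ∪ e).card ≤ 6 := by
    have h1 : f₁ ∪ f₂ ∪ e ⊆ insert x (f₁ ∪ f₂.erase z) := by
      intro t ht
      simp only [hee, Finset.mem_union, Finset.mem_insert, Finset.mem_singleton,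
        Finset.mem_erase] at ht ⊢
      by_cases htz : t = z
      · exact Or.inr (Or.inl (htz ▸ hz₁))
      · rcases ht with (ht | ht) | rfl | rfl | rfl
        · exact Or.inr (Or.inl ht)
        · exact Or.inr (Or.inr ⟨htz, ht⟩)
        · exact Or.inl rfl
        · exact Or.inr (Or.inl hy₁.2)
        · exact Or.inr (Or.inr ⟨htz, hy₂.2⟩)
    have h2 := Finset.card_le_card h1
    have h3 := Finset.card_insert_le x (f₁ ∪ f₂.erase z)
    have h4 := Finset.card_union_le f₁ (f₂.erase z)
    rw [Finset.card_erase_of_mem hz₂, hcard f₁ hf₁, hcard f₂ hf₂] at h4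
    omega
  obtain ⟨hZ6, hZ⟩ := hclosed _ (Finset.union_subset (Finset.union_subset (hGS _ hf₁) (hGS _ hf₂))
    (hGS _ he)) hZcard 3 hrank (by omega)
  set Z := f₁ ∪ f₂ ∪ e with hZdef
  have heZ : e ⊆ Z := Finset.subset_union_right
  have hrest : (Z \ e).card = 3 := by
    rw [Finset.card_sdiff_of_subset heZ, hZ6, hecard]
  obtain ⟨s, t, u, hst, hsu, htu, hrest⟩ := Finset.card_eq_three.1 hrest
  have hZmem : ∀ v, v ∈ Z → v ∈ e ∨ v = s ∨ v = t ∨ v = u := fun v hv => by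
    by_cases hve : v ∈ e
    · exact Or.inl hve
    · have : v ∈ Z \ e := Finset.mem_sdiff.2 ⟨hv, hve⟩
      rw [hrest] at this
      simpa using Or.inr (a := v ∈ e) this
  have hout : ∀ v, v = s ∨ v = t ∨ v = u → v ∉ e := fun v hv => by
    have : v ∈ Z \ e := by rw [hrest]; simpa using hv
    exact (Finset.mem_sdiff.1 this).2
  -- colouring `x, y₁` and one further point red forces the complementary triple
  have hforce : ∀ p q r, (p = s ∨ p = t ∨ p = u) →
      (∀ v, v ∈ Z → v ∈ e ∨ v = p ∨ v = q ∨ v = r) → ({y₂, q, r} : Finset α) ∈ G := by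
    intro p q r hp hmem
    obtain ⟨g, hg, hgZ, hgC⟩ := hcol Z hZ ⟨e, he, heZ⟩ {x, y₁, p}
    have hpe := hout p hp
    rcases hgC with hgC | hgC
    · exfalso
      have hc : ({x, y₁, p} : Finset α).card = 3 :=
        Finset.card_eq_three.2 ⟨x, y₁, p, hxy₁, fun h => hpe (h ▸ hx), fun h => hpe (h ▸ hy₁.1), rfl⟩
      have hgeq := Finset.eq_of_subset_of_card_le hgC (by rw [hc, hcard g hg])
      have hge := hlin g hg e he x y₁ hxy₁ (by rw [hgeq]; simp) (by rw [hgeq]; simp) hx hy₁.1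
      exact hpe (hge ▸ (by rw [hgeq]; simp : p ∈ g))
    · have hsub : g ⊆ {y₂, q, r} := fun v hv => by
        have hvC := Finset.disjoint_left.1 hgC hv
        have := hmem v (hgZ hv)
        simp only [hee, Finset.mem_insert, Finset.mem_singleton] at this hvC ⊢
        tauto
      rwa [← Finset.eq_of_subset_of_card_le hsub (by rw [hcard g hg]; exact Finset.card_le_three)]
  have hA := hforce s t u (by simp) hZmem
  have hB := hforce t s u (by simp) (fun v hv => by have := hZmem v hv; tauto)
  have hyu : y₂ ≠ u := fun h => hout u (by simp) (h ▸ hy₂.1)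
  -- The triples forced by the choices `s` and `t` of the third red point share `y₂` and `u`, which
  -- contradicts linearity.
  have hAB := hlin _ hA _ hB y₂ u hyu (by simp) (by simp) (by simp) (by simp)
  have htm : t ∈ ({y₂, s, u} : Finset α) := hAB ▸ (by simp : t ∈ ({y₂, t, u} : Finset α))
  simp only [Finset.mem_insert, Finset.mem_singleton] at htm
  rcases htm with h | h | h
  · exact hout t (by simp) (h ▸ hy₂.1)
  · exact hst h.symm
  · exact htu h

/-- The vertex set of a connected uncolourable system of triples has a rare exploration. -/
theorem hasRareExploration_of_triples (hne : G.Nonempty) (hcard : ∀ g ∈ G, g.card = 3)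
    (hcross : ∀ g ∈ G, ∀ x ∈ g, ∃ h ∈ G, g ∩ h = {x}) (hE : ∀ g ∈ G, E g) (hGS : ∀ g ∈ G, g ⊆ S)
    (hcol : ∀ Z : Finset α, (∀ g ∈ G, ¬ Disjoint g Z → g ⊆ Z) → (∃ g ∈ G, g ⊆ Z) →
      ∀ C : Finset α, ∃ g ∈ G, g ⊆ Z ∧ (g ⊆ C ∨ Disjoint g C))
    (hSV : S ⊆ V) (hD : 6 ≤ D) :
    HasRareExploration E V 2 1 (1 / 2) (1 / 2) D L S := by
  -- Two unexplored triples `f₁`, `f₂` are kept at two points of the last triple `e`. The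
  -- exploration proceeds along `f₁`; the triple `f₂` is held in reserve for the case where adding
  -- `f₁` closes a component.
  let Inv : Finset α → α → Finset α → Finset α → Finset α → α → α → Prop :=
    fun W y e f₁ f₂ x y₂ => e ∈ G ∧ f₁ ∈ G ∧ f₂ ∈ G ∧ x ∈ e ∧ x ≠ y ∧ x ≠ y₂ ∧ y ≠ y₂ ∧ e ⊆ W ∧
      e ∩ f₁ = {y} ∧ e ∩ f₂ = {y₂} ∧ ¬ f₁ ⊆ W ∧ ¬ f₂ ⊆ W
  obtain ⟨e, he⟩ := hne
  obtain ⟨x, y, y₂, hxy, hxy₂, hyy₂, hee⟩ := Finset.card_eq_three.1 (hcard e he)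
  obtain ⟨f₁, hf₁, hef₁⟩ := hcross e he y (by rw [hee]; simp)
  obtain ⟨f₂, hf₂, hef₂⟩ := hcross e he y₂ (by rw [hee]; simp)
  have hnot : ∀ f ∈ G, ∀ v, e ∩ f = {v} → ¬ f ⊆ e := fun f hf v hv h => by
    rw [Finset.inter_eq_right.2 h] at hv
    have := hcard f hf
    rw [hv, Finset.card_singleton] at this
    omega
  have hbase : Inv e y e f₁ f₂ x y₂ := ⟨he, hf₁, hf₂, by rw [hee]; simp, hxy, hxy₂, hyy₂,
    subset_rfl, hef₁, hef₂, hnot f₁ hf₁ y hef₁, hnot f₂ hf₂ y₂ hef₂⟩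
  have hstart : (e, y) ∈ globalStep E V 3 1 {((∅ : Finset α), (default : α))} := by
    have hk : ChainRank E ∅ e 1 := by
      have := (ChainRank.zero (E := E) (Finset.Subset.refl ∅)).add_edge (hE e he)
        (fun h => by
          have := hcard e he
          rw [Finset.subset_empty.1 h] at this
          simp at this)
      simpa using this
    have := mem_globalStep_start (y := y) ((hGS e he).trans hSV) hk (by rw [hee]; simp)
    rwa [hcard e he] at this
  have hstep : ∀ W y, W ⊆ S → (∃ e f₁ f₂ x y₂, Inv W y e f₁ f₂ x y₂) →
      ((∃ T : Finset α, T ⊆ S ∧ Disjoint W T ∧ T.card = 2 ∧ ChainRank E W (W ∪ T) 2) ∨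
        ∃ e f₁ f₂ x y₂, Inv W y e f₁ f₂ x y₂ ∧ (f₁ \ W).card ≤ 1) ∨
      ∃ (T : Finset α) (y' : α), T ⊆ S ∧ Disjoint W T ∧ y' ∈ T ∧ T.card = 2 ∧
        ChainRank E {y} ({y} ∪ T) 1 ∧ ∃ e f₁ f₂ x y₂, Inv (W ∪ T) y' e f₁ f₂ x y₂ := by
    rintro W y - ⟨e, f₁, f₂, x, y₂, hI⟩
    obtain ⟨he, hf₁, hf₂, hx, hxy, hxy₂, hyy₂, heW, hef₁, hef₂, hf₁W, hf₂W⟩ := hI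
    have hyf : y ∈ e ∩ f₁ := by rw [hef₁]; simp
    rw [Finset.mem_inter] at hyf
    rcases sdiff_card_of_card_eq_three (hcard f₁ hf₁) hyf.2 (heW hyf.1) with
      h1 | ⟨t, u, htW, huW, htu, hyt, hyu, hgeq, hgW'⟩
    · exact Or.inl (Or.inr ⟨e, f₁, f₂, x, y₂,
        ⟨he, hf₁, hf₂, hx, hxy, hxy₂, hyy₂, heW, hef₁, hef₂, hf₁W, hf₂W⟩, h1⟩)
    · have hTS : f₁ \ W ⊆ S := Finset.sdiff_subset.trans (hGS f₁ hf₁)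
      have hWT : Disjoint W (f₁ \ W) := Finset.disjoint_sdiff
      have hWg : W ∪ f₁ \ W = W ∪ f₁ := Finset.union_sdiff_self_eq_union
      have hc2 : (f₁ \ W).card = 2 := by rw [hgW', Finset.card_pair htu]
      have htf : t ∈ f₁ := by rw [hgeq]; simp
      have huf : u ∈ f₁ := by rw [hgeq]; simp
      obtain ⟨h, hh, hgh⟩ := hcross f₁ hf₁ t htf
      obtain ⟨h', hh', hgh'⟩ := hcross f₁ hf₁ u huf
      by_cases hsub : h ⊆ W ∪ f₁
      · refine Or.inl (Or.inl ⟨f₁ \ W, hTS, hWT, hc2, ?_⟩)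
        rw [hWg]
        exact chainRank_two_of_inter (hE _ hf₁) (hE h hh) htW huf huW htu.symm hgh hsub
      by_cases hsub' : h' ⊆ W ∪ f₁
      · refine Or.inl (Or.inl ⟨f₁ \ W, hTS, hWT, hc2, ?_⟩)
        rw [hWg]
        exact chainRank_two_of_inter (hE _ hf₁) (hE h' hh') huW htf htW htu hgh' hsub'
      refine Or.inr ⟨f₁ \ W, t, hTS, hWT, by rw [hgW']; simp, hc2, ?_, f₁, h, h', y, u, ?_⟩
      · rw [hgW']
        exact chainRank_one_triple hyt (hgeq ▸ hE _ hf₁)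
      · rw [hWg]
        exact ⟨hf₁, hh, hh', hyf.2, hyt, hyu, htu, Finset.subset_union_right, hgh, hgh', hsub,
          hsub'⟩
  obtain ⟨i, hi, s, hs, hsS, hsi⟩ := exists_iterate_localStep
    (Inv := fun W y => ∃ e f₁ f₂ x y₂, Inv W y e f₁ f₂ x y₂)
    (Halt := fun W y => (∃ T : Finset α, T ⊆ S ∧ Disjoint W T ∧ T.card = 2 ∧
      ChainRank E W (W ∪ T) 2) ∨
      ∃ e f₁ f₂ x y₂, Inv W y e f₁ f₂ x y₂ ∧ (f₁ \ W).card ≤ 1)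
    hSV hstep hstart (hGS e he) ⟨e, f₁, f₂, x, y₂, hbase⟩ L
  rcases hsi with rfl | ⟨T, hTS, hd, hT2, hk⟩ | ⟨e, f₁, f₂, x, y₂, hI, hf₁s⟩
  · refine ⟨3, by omega, 1, by omega, 0, Nat.zero_le _, 0, Nat.zero_le _, 0, Nat.zero_le _, 0,
      Nat.zero_le _, i, le_rfl, 0, Nat.zero_le _, Or.inr ⟨?_, le_rfl⟩, s,
      mem_globalStep_zero (mem_globalStep_zero hs), hsS⟩
    norm_num
  · refine ⟨3, by omega, 1, by omega, T.card, by omega, 2, by omega, 0, Nat.zero_le _, 0,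
      Nat.zero_le _, i, hi, 0, Nat.zero_le _, Or.inl ?_, (s.1 ∪ T, s.2),
      mem_globalStep_zero (mem_globalStep hs (hTS.trans hSV) hd hk (by simp)),
      Finset.union_subset hsS hTS⟩
    rw [hT2]
    norm_num
  · obtain ⟨he, hf₁, hf₂, hx, hxy, hxy₂, hyy₂, heW, hef₁, hef₂, hf₁W, hf₂W⟩ := hI
    have hTS : f₁ \ s.1 ⊆ S := Finset.sdiff_subset.trans (hGS f₁ hf₁)
    have hd : Disjoint s.1 (f₁ \ s.1) := Finset.disjoint_sdiff
    have hWf : s.1 ∪ f₁ \ s.1 = s.1 ∪ f₁ := Finset.union_sdiff_self_eq_union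
    have hk : ChainRank E s.1 (s.1 ∪ f₁ \ s.1) 1 := by
      rw [hWf]
      exact (ChainRank.zero (E := E) (Finset.Subset.refl s.1)).add_edge (hE f₁ hf₁) hf₁W
    have hcr : ((f₁ \ s.1).card : ℝ) ≤ 1 := by exact_mod_cast hf₁s
    -- Adding `f₁` with at most one new point lowers the total weight from `1 / 2` to at most `0`.
    -- If some triple leaves the resulting set, the exploration goes on from there. Otherwise `f₂`
    -- is covered and meets `f₁` outside the old set, so `e`, `f₁`, `f₂` form a triangle.
    by_cases hopen : ∃ g ∈ G, ¬ Disjoint g (s.1 ∪ f₁ \ s.1) ∧ ¬ g ⊆ s.1 ∪ f₁ \ s.1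
    · obtain ⟨g, hg, hgd, hgs⟩ := hopen
      obtain ⟨v, hvg, hvs⟩ := Finset.not_disjoint_iff.1 hgd
      have hs2 := mem_globalStep hs (hTS.trans hSV) hd hk (y := v)
        (Finset.mem_insert_of_mem hvs)
      obtain ⟨j, hj, s', hs', hs'S, rfl | ⟨T, k', hTS', hd', hT2, hk', hneg⟩⟩ :=
        exists_localStep_of_open hcard hcross hE hGS hSV hs2 (Finset.union_subset hsS hTS) hg hvg
          hvs hgs L
      · refine ⟨3, by omega, 1, by omega, (f₁ \ s.1).card, by omega, 1, by omega, 0,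
          Nat.zero_le _, 0, Nat.zero_le _, i, hi, j, le_rfl, Or.inr ⟨?_, by omega⟩, s',
          mem_globalStep_zero hs', hs'S⟩
        push_cast
        linarith
      · refine ⟨3, by omega, 1, by omega, (f₁ \ s.1).card, by omega, 1, by omega, T.card,
          by omega, k', hk'.le_of_card_le (by omega), i, hi, j, hj, Or.inl ?_,
          (s'.1 ∪ T, s'.2), mem_globalStep hs' (hTS'.trans hSV) hd' hk' (by simp),
          Finset.union_subset hs'S hTS'⟩
        push_cast
        linarith
    · push Not at hopen
      have hy₂f : y₂ ∈ e ∩ f₂ := by rw [hef₂]; simp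
      rw [Finset.mem_inter] at hy₂f
      have hf₂sub := hopen f₂ hf₂ (Finset.not_disjoint_iff.2
        ⟨y₂, hy₂f.2, Finset.mem_union_left _ (heW hy₂f.1)⟩)
      obtain ⟨z, hzf₂, hzW⟩ := Finset.not_subset.1 hf₂W
      have hzf₁ : z ∈ f₁ := by
        rcases Finset.mem_union.1 (hf₂sub hzf₂) with h | h
        · exact absurd h hzW
        · exact (Finset.mem_sdiff.1 h).1
      exact hasRareExploration_of_triangle hcard hcross hE hGS hcol hSV hD he hf₁ hf₂ hx hxy hxy₂
        hyy₂ hef₁ hef₂ hzf₁ hzf₂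

end Triples

/-! ### Counting extensions -/

section Counting

/-- `g` is the set of entries of a distinct solution of `A`. -/
def LinearEquation.IsSolutionSet {k : ℕ} (A : LinearEquation k) (g : Finset ℤ) : Prop :=
  ∃ x : Fin k → ℤ, A.IsDistinctSolution x ∧ Finset.univ.image x = g

/-- The set of entries of a distinct solution of `A` or of `B`. -/
def IsSolutionEdge {kA kB : ℕ} (A : LinearEquation kA) (B : LinearEquation kB) (g : Finset ℤ) :
    Prop :=
  A.IsSolutionSet g ∨ B.IsSolutionSet g

lemma LinearEquation.IsSolutionSet.card_eq {k : ℕ} {A : LinearEquation k} {g : Finset ℤ}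
    (h : A.IsSolutionSet g) : g.card = k := by
  obtain ⟨x, ⟨-, hx⟩, rfl⟩ := h
  rw [Finset.card_image_of_injective _ hx, Finset.card_univ, Fintype.card_fin]

/-- There are few ways to complete a given set to a solution by a single element. -/
lemma LinearEquation.exists_completions {k : ℕ} (A : LinearEquation k) (Y : Finset ℤ) :
    ∃ C : Finset ℤ, C.card ≤ k * (Y.card + 1) ^ k ∧
      ∀ g t, A.IsSolutionSet g → t ∈ g → g ⊆ insert t Y → t ∈ C := by
  classical
  refine ⟨((Finset.univ : Finset (Fin k)) ×ˢ Fintype.piFinset fun _ : Fin k => insert 0 Y).image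
    fun q => (A.rhs - ∑ i, A.coeff i * q.2 i) / A.coeff q.1, ?_, ?_⟩
  · refine Finset.card_image_le.trans ?_
    rw [Finset.card_product, Finset.card_univ, Fintype.card_fin, Fintype.card_piFinset_const]
    exact Nat.mul_le_mul_left _ (Nat.pow_le_pow_left (Finset.card_insert_le 0 Y) _)
  · rintro g t ⟨x, ⟨hsum, hinj⟩, rfl⟩ ht hsub
    obtain ⟨j, -, rfl⟩ := Finset.mem_image.1 ht
    refine Finset.mem_image.2 ⟨(j, Function.update x j 0), ?_, ?_⟩
    · refine Finset.mem_product.2 ⟨Finset.mem_univ _, Fintype.mem_piFinset.2 fun i => ?_⟩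
      by_cases hij : i = j
      · subst hij; simp
      · change Function.update x j 0 i ∈ insert 0 Y
        rw [Function.update_of_ne hij]
        have := hsub (Finset.mem_image_of_mem x (Finset.mem_univ i))
        rcases Finset.mem_insert.1 this with h | h
        · exact absurd (hinj h) hij
        · exact Finset.mem_insert_of_mem h
    · have h1 : ∑ i, A.coeff i * Function.update x j 0 i = A.rhs - A.coeff j * x j := by
        rw [← hsum, ← Finset.sum_erase_add _ _ (Finset.mem_univ j),
          ← Finset.sum_erase_add _ _ (Finset.mem_univ j)]
        simp only [Function.update_self, mul_zero, add_zero, add_sub_cancel_right]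
        refine Finset.sum_congr rfl fun i hi => ?_
        rw [Function.update_of_ne (Finset.ne_of_mem_erase hi)]
      simp only [h1, sub_sub_cancel]
      exact Int.mul_ediv_cancel_left _ (A.coeff_ne_zero j)

variable {kA kB : ℕ} (A : LinearEquation kA) (B : LinearEquation kB)

lemma exists_edge_completions (hAB : kA ≤ kB) (Y : Finset ℤ) :
    ∃ C : Finset ℤ, C.card ≤ 2 * kB * (Y.card + 1) ^ kB ∧
      ∀ g t, IsSolutionEdge A B g → t ∈ g → g ⊆ insert t Y → t ∈ C := by
  classical
  obtain ⟨CA, hCA, hA⟩ := A.exists_completions Y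
  obtain ⟨CB, hCB, hB⟩ := B.exists_completions Y
  refine ⟨CA ∪ CB, (Finset.card_union_le _ _).trans ?_, fun g t hg ht hs => ?_⟩
  · have : kA * (Y.card + 1) ^ kA ≤ kB * (Y.card + 1) ^ kB :=
      Nat.mul_le_mul hAB (Nat.pow_le_pow_right (Nat.succ_pos _) hAB)
    calc CA.card + CB.card ≤ kB * (Y.card + 1) ^ kB + kB * (Y.card + 1) ^ kB :=
          Nat.add_le_add (hCA.trans this) hCB
      _ = _ := by ring
  · rcases hg with hg | hg
    · exact Finset.mem_union_left _ (hA g t hg ht hs)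
    · exact Finset.mem_union_right _ (hB g t hg ht hs)

lemma extensions_eq_empty {E : Finset ℤ → Prop} {V R : Finset ℤ} {N k : ℕ} (h : N < k) :
    extensions E V R N k = ∅ := by
  refine Finset.eq_empty_of_forall_notMem fun T hT => ?_
  obtain ⟨-, hc, hk⟩ := mem_extensions.1 hT
  have := hk.le_of_card_le hc.le
  omega

/-- Each of the `k` edges has a vertex determined, up to boundedly many choices, by what is left
after removing it (`ChainRank.exists_erase`). Only `N - k` elements are chosen freely. -/
lemma card_extensions_le (hAB : kA ≤ kB) (V R : Finset ℤ) (N k : ℕ) :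
    (extensions (IsSolutionEdge A B) V R N k).card ≤
      (2 * kB * (R.card + N + 1) ^ kB) ^ k * V.card ^ (N - k) := by
  induction k generalizing N with
  | zero =>
    calc (extensions (IsSolutionEdge A B) V R N 0).card ≤ (V.powersetCard N).card := by
          refine Finset.card_le_card fun T hT => ?_
          obtain ⟨h1, h2, -⟩ := mem_extensions.1 hT
          exact Finset.mem_powersetCard.2 ⟨h1, h2⟩
      _ ≤ V.card ^ N := by rw [Finset.card_powersetCard]; exact Nat.choose_le_pow _ _
      _ = _ := by simp
  | succ k ih =>
    rcases Nat.eq_zero_or_pos N with rfl | hN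
    · simp [extensions_eq_empty (Nat.succ_pos k)]
    obtain ⟨N, rfl⟩ : ∃ N', N = N' + 1 := ⟨N - 1, by omega⟩
    choose C hCcard hC using exists_edge_completions A B hAB
    have hsub : extensions (IsSolutionEdge A B) V R (N + 1) (k + 1) ⊆
        (extensions (IsSolutionEdge A B) V R N k).biUnion fun T' =>
          (C (R ∪ T')).image fun t => insert t T' := by
      intro T hT
      obtain ⟨hTV, hTc, hk⟩ := mem_extensions.1 hT
      obtain ⟨t, htX, htR, hk', g, hg, htg, hgX⟩ := hk.exists_erase
      have htT : t ∈ T := (Finset.mem_union.1 htX).resolve_left htR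
      have herase : (R ∪ T).erase t = R ∪ T.erase t := by
        rw [Finset.erase_union_distrib, Finset.erase_eq_of_notMem htR]
      rw [herase] at hk'
      refine Finset.mem_biUnion.2 ⟨T.erase t, mem_extensions.2
        ⟨(Finset.erase_subset _ _).trans hTV, ?_, hk'⟩, Finset.mem_image.2 ⟨t, ?_, ?_⟩⟩
      · rw [Finset.card_erase_of_mem htT, hTc, Nat.add_sub_cancel]
      · refine hC _ g t hg htg (hgX.trans ?_)
        rw [← herase, Finset.insert_erase htX]
      · exact Finset.insert_erase htT
    calc _ ≤ ∑ T' ∈ extensions (IsSolutionEdge A B) V R N k,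
          ((C (R ∪ T')).image fun t => insert t T').card :=
          (Finset.card_le_card hsub).trans Finset.card_biUnion_le
      _ ≤ ∑ T' ∈ extensions (IsSolutionEdge A B) V R N k,
          2 * kB * (R.card + (N + 1) + 1) ^ kB := by
          refine Finset.sum_le_sum fun T' hT' => Finset.card_image_le.trans ((hCcard _).trans ?_)
          refine Nat.mul_le_mul_left _ (Nat.pow_le_pow_left ?_ _)
          have := Finset.card_union_le R T'
          rw [(mem_extensions.1 hT').2.1] at this
          omega
      _ = (extensions (IsSolutionEdge A B) V R N k).card *
          (2 * kB * (R.card + (N + 1) + 1) ^ kB) := by rw [Finset.sum_const, smul_eq_mul]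
      _ ≤ ((2 * kB * (R.card + (N + 1) + 1) ^ kB) ^ k * V.card ^ (N - k)) *
          (2 * kB * (R.card + (N + 1) + 1) ^ kB) := by
          refine Nat.mul_le_mul_right _ ((ih N).trans (Nat.mul_le_mul_right _ ?_))
          exact Nat.pow_le_pow_left (Nat.mul_le_mul_left _ (Nat.pow_le_pow_left (by omega) _)) _
      _ = _ := by rw [Nat.add_sub_add_right]; ring

/-- The weighted number of extensions at density `q ≤ c n ^ (β - 1)`. -/
lemma card_extensions_mul_pow_le (hAB : kA ≤ kB) {V : Finset ℤ} {n : ℕ} (hV : V.card = n)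
    (hn : 1 ≤ n) {q c β : ℝ} (hq0 : 0 ≤ q) (hc : 0 ≤ c) (hq : q ≤ c * (n : ℝ) ^ (β - 1))
    (R : Finset ℤ) (N k : ℕ) :
    ((extensions (IsSolutionEdge A B) V R N k).card : ℝ) * q ^ N ≤
      (2 * kB * (R.card + N + 1) ^ kB) ^ k * c ^ N * (n : ℝ) ^ (β * N - k) := by
  have hnpos : (0 : ℝ) < n := by exact_mod_cast hn
  rcases Nat.lt_or_ge N k with h | h
  · rw [extensions_eq_empty h]
    simp only [Finset.card_empty, Nat.cast_zero, zero_mul]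
    positivity
  have h1 : ((extensions (IsSolutionEdge A B) V R N k).card : ℝ) ≤
      (2 * kB * (R.card + N + 1) ^ kB) ^ k * (n : ℝ) ^ (N - k) := by
    have := card_extensions_le A B hAB V R N k
    rw [hV] at this
    exact_mod_cast this
  have h2 : q ^ N ≤ c ^ N * (n : ℝ) ^ ((β - 1) * N) := by
    calc q ^ N ≤ (c * (n : ℝ) ^ (β - 1)) ^ N := pow_le_pow_left₀ hq0 hq N
      _ = _ := by rw [mul_pow, Real.rpow_mul hnpos.le, Real.rpow_natCast]
  calc _ ≤ ((2 * kB * (R.card + N + 1) ^ kB) ^ k * (n : ℝ) ^ (N - k)) *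
        (c ^ N * (n : ℝ) ^ ((β - 1) * N)) := by gcongr
    _ = (2 * kB * (R.card + N + 1) ^ kB) ^ k * c ^ N *
        ((n : ℝ) ^ (N - k) * (n : ℝ) ^ ((β - 1) * N)) := by ring
    _ = _ := by
        rw [← Real.rpow_natCast (n : ℝ) (N - k), ← Real.rpow_add hnpos, Nat.cast_sub h]
        congr 2
        ring

end Counting

/-! ### Weights of families of explorations -/

section Weights

lemma Finset.sum_biUnion_le_sum_sum {ι κ : Type*} [DecidableEq κ] (s : Finset ι) (t : ι → Finset κ)
    {f : κ → ℝ} (hf : ∀ x, 0 ≤ f x) : ∑ x ∈ s.biUnion t, f x ≤ ∑ i ∈ s, ∑ x ∈ t i, f x := by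
  classical
  induction s using Finset.induction_on with
  | empty => simp
  | insert i s hi ih =>
    rw [Finset.biUnion_insert, Finset.sum_insert hi]
    have h1 := Finset.sum_union_inter (s₁ := t i) (s₂ := s.biUnion t) (f := f)
    have h2 : 0 ≤ ∑ x ∈ t i ∩ s.biUnion t, f x := Finset.sum_nonneg fun x _ => hf x
    linarith

/-- The expected number of sets of a family that lie in a random set of density `q`. -/
def familyWeight {α : Type*} (q : ℝ) (𝓕 : Finset (Finset α × α)) : ℝ :=
  ∑ s ∈ 𝓕, q ^ s.1.card

lemma familyWeight_nonneg {α : Type*} {q : ℝ} (hq : 0 ≤ q) (𝓕 : Finset (Finset α × α)) :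
    0 ≤ familyWeight q 𝓕 := Finset.sum_nonneg fun _ _ => pow_nonneg hq _

/-- The weight of a family obtained by attaching disjoint `N`-sets, and choosing a new marked
point, in all possible ways. -/
lemma familyWeight_biUnion_le {q : ℝ} (hq : 0 ≤ q) {𝓕 : Finset (Finset ℤ × ℤ)} {N : ℕ} {κ m : ℝ}
    (hm : 0 ≤ m) (X : Finset ℤ × ℤ → Finset (Finset ℤ)) (Y : Finset ℤ × ℤ → Finset ℤ → Finset ℤ)
    (hN : ∀ s ∈ 𝓕, ∀ T ∈ X s, T.card = N) (hX : ∀ s ∈ 𝓕, ((X s).card : ℝ) * q ^ N ≤ κ)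
    (hY : ∀ s ∈ 𝓕, ∀ T ∈ X s, ((Y s T).card : ℝ) ≤ m) :
    familyWeight q (𝓕.biUnion fun s => ((X s).filter (Disjoint s.1)).biUnion fun T =>
      (Y s T).image fun y => (s.1 ∪ T, y)) ≤ κ * m * familyWeight q 𝓕 := by
  have hpos : ∀ s : Finset ℤ × ℤ, 0 ≤ q ^ s.1.card := fun s => pow_nonneg hq _
  rw [familyWeight, familyWeight, Finset.mul_sum]
  refine (Finset.sum_biUnion_le_sum_sum _ _ hpos).trans (Finset.sum_le_sum fun s hs => ?_)
  refine (Finset.sum_biUnion_le_sum_sum _ _ hpos).trans ?_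
  calc _ ≤ ∑ T ∈ (X s).filter (Disjoint s.1), m * (q ^ N * q ^ s.1.card) := by
        refine Finset.sum_le_sum fun T hT => ?_
        obtain ⟨hT, hd⟩ := Finset.mem_filter.1 hT
        have h1 : ∀ s' ∈ (Y s T).image (fun y => (s.1 ∪ T, y)),
            q ^ s'.1.card = q ^ N * q ^ s.1.card := by
          intro s' hs'
          obtain ⟨y, -, rfl⟩ := Finset.mem_image.1 hs'
          rw [Finset.card_union_of_disjoint hd, hN s hs T hT, pow_add, mul_comm]
        rw [Finset.sum_congr rfl h1, Finset.sum_const, nsmul_eq_mul]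
        refine mul_le_mul_of_nonneg_right ?_ (by positivity)
        exact le_trans (by exact_mod_cast Finset.card_image_le) (hY s hs T hT)
    _ = (((X s).filter (Disjoint s.1)).card * q ^ N) * m * q ^ s.1.card := by
        rw [Finset.sum_const, nsmul_eq_mul]; ring
    _ ≤ κ * m * q ^ s.1.card := by
        refine mul_le_mul_of_nonneg_right (mul_le_mul_of_nonneg_right ?_ hm) (by positivity)
        refine le_trans ?_ (hX s hs)
        refine mul_le_mul_of_nonneg_right ?_ (by positivity)
        exact_mod_cast Finset.card_filter_le _ _

lemma card_le_of_mem_globalStep {E : Finset ℤ → Prop} {V : Finset ℤ} {N k M : ℕ}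
    {𝓕 : Finset (Finset ℤ × ℤ)} (h𝓕 : ∀ s ∈ 𝓕, s.1.card ≤ M) :
    ∀ s ∈ globalStep E V N k 𝓕, s.1.card ≤ M + N := by
  intro s hs
  obtain ⟨s₀, hs₀, hs⟩ := Finset.mem_biUnion.1 hs
  obtain ⟨T, hT, hs⟩ := Finset.mem_biUnion.1 hs
  obtain ⟨y, -, rfl⟩ := Finset.mem_image.1 hs
  have := (mem_extensions.1 (Finset.mem_filter.1 hT).1).2.1
  exact (Finset.card_union_le _ _).trans (Nat.add_le_add (h𝓕 s₀ hs₀) this.le)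

lemma card_le_of_mem_localStep {E : Finset ℤ → Prop} {V : Finset ℤ} {N k M : ℕ}
    {𝓕 : Finset (Finset ℤ × ℤ)} (h𝓕 : ∀ s ∈ 𝓕, s.1.card ≤ M) :
    ∀ s ∈ localStep E V N k 𝓕, s.1.card ≤ M + N := by
  intro s hs
  obtain ⟨s₀, hs₀, hs⟩ := Finset.mem_biUnion.1 hs
  obtain ⟨T, hT, hs⟩ := Finset.mem_biUnion.1 hs
  obtain ⟨y, -, rfl⟩ := Finset.mem_image.1 hs
  have := (mem_extensions.1 (Finset.mem_filter.1 hT).1).2.1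
  exact (Finset.card_union_le _ _).trans (Nat.add_le_add (h𝓕 s₀ hs₀) this.le)

lemma card_le_of_mem_iterate_localStep {E : Finset ℤ → Prop} {V : Finset ℤ} {N k M : ℕ}
    {𝓕 : Finset (Finset ℤ × ℤ)} (h𝓕 : ∀ s ∈ 𝓕, s.1.card ≤ M) (i : ℕ) :
    ∀ s ∈ (localStep E V N k)^[i] 𝓕, s.1.card ≤ M + i * N := by
  induction i with
  | zero => simpa using h𝓕
  | succ i ih =>
    rw [Function.iterate_succ_apply']
    intro s hs
    have := card_le_of_mem_localStep ih s hs
    rw [Nat.succ_mul]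
    omega

variable {kA kB : ℕ} {A : LinearEquation kA} {B : LinearEquation kB} {V : Finset ℤ} {n : ℕ}
  {q c β : ℝ}

/-- The loss is polynomial in the size `M` of the structure. This is affordable because `M` will be
of order `log n` and only three global steps are made. -/
lemma familyWeight_globalStep_le (hAB : kA ≤ kB) (hB : 1 ≤ kB) (hV : V.card = n) (hn : 1 ≤ n)
    (hq0 : 0 ≤ q) (hc0 : 0 ≤ c) (hc1 : c ≤ 1) (hq : q ≤ c * (n : ℝ) ^ (β - 1)) {N k M D : ℕ}
    (hk : k ≤ D) {𝓕 : Finset (Finset ℤ × ℤ)} (h𝓕 : ∀ s ∈ 𝓕, s.1.card + N ≤ M) :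
    familyWeight q (globalStep (IsSolutionEdge A B) V N k 𝓕) ≤
      (2 * kB * ((M : ℝ) + 1) ^ kB) ^ D * (M + 1) * (n : ℝ) ^ (β * N - k) * familyWeight q 𝓕 := by
  have hM : (0 : ℝ) ≤ (M : ℝ) + 1 := by positivity
  have hbase : (1 : ℝ) ≤ 2 * kB * ((M : ℝ) + 1) ^ kB := by
    have h1 : (1 : ℝ) ≤ ((M : ℝ) + 1) ^ kB := one_le_pow₀ (by linarith [M.cast_nonneg (α := ℝ)])
    have h2 : (1 : ℝ) ≤ kB := by exact_mod_cast hB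
    nlinarith
  refine (familyWeight_biUnion_le (N := N)
    (κ := (2 * kB * ((M : ℝ) + 1) ^ kB) ^ D * (n : ℝ) ^ (β * N - k))
    hq0 hM _ _ ?_ ?_ ?_).trans (le_of_eq (by ring))
  · exact fun s _ T hT => (mem_extensions.1 hT).2.1
  · intro s hs
    refine (card_extensions_mul_pow_le A B hAB hV hn hq0 hc0 hq s.1 N k).trans ?_
    have h1 : ((s.1.card : ℝ) + N + 1) ≤ M + 1 := by
      have : (s.1.card : ℝ) + N ≤ M := by exact_mod_cast h𝓕 s hs
      linarith
    refine mul_le_mul_of_nonneg_right ?_ (by positivity)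
    calc _ ≤ (2 * kB * ((s.1.card : ℝ) + N + 1) ^ kB) ^ k * 1 := by
          gcongr
          exact pow_le_one₀ hc0 hc1
      _ ≤ (2 * kB * ((M : ℝ) + 1) ^ kB) ^ k := by rw [mul_one]; gcongr
      _ ≤ _ := pow_le_pow_right₀ hbase hk
  · intro s hs T hT
    have h1 := Finset.card_insert_le s.2 (s.1 ∪ T)
    have h2 := Finset.card_union_le s.1 T
    rw [(mem_extensions.1 hT).2.1] at h2
    have h3 := h𝓕 s hs
    exact_mod_cast (by omega : (insert s.2 (s.1 ∪ T)).card ≤ M + 1)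

/-- The extension is based at one marked point and has weight `0`, so the constant involves neither
`n` nor the size of the structure: `N + 2` is `|{y}| + N + 1`, and the last factor `N` counts the
new marked points. -/
lemma familyWeight_localStep_le (hAB : kA ≤ kB) (hV : V.card = n) (hn : 1 ≤ n)
    (hq0 : 0 ≤ q) (hc0 : 0 ≤ c) (hq : q ≤ c * (n : ℝ) ^ (β - 1)) {N k : ℕ} (hNk : β * N = k)
    (hc : (2 * kB * ((N : ℝ) + 2) ^ kB) ^ k * c ^ N * N ≤ 1 / 2) (𝓕 : Finset (Finset ℤ × ℤ)) :
    familyWeight q (localStep (IsSolutionEdge A B) V N k 𝓕) ≤ 1 / 2 * familyWeight q 𝓕 := by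
  refine (familyWeight_biUnion_le (N := N) (m := N)
    (κ := (2 * kB * ((N : ℝ) + 2) ^ kB) ^ k * c ^ N) hq0 (Nat.cast_nonneg N) _ _ ?_ ?_ ?_).trans
    (mul_le_mul_of_nonneg_right hc (familyWeight_nonneg hq0 𝓕))
  · exact fun s _ T hT => (mem_extensions.1 hT).2.1
  · intro s _
    refine (card_extensions_mul_pow_le A B hAB hV hn hq0 hc0 hq {s.2} N k).trans (le_of_eq ?_)
    rw [hNk, sub_self, Real.rpow_zero, mul_one, Finset.card_singleton]
    push_cast
    ring
  · intro s _ T hT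
    rw [(mem_extensions.1 hT).2.1]

lemma familyWeight_iterate_localStep_le (hAB : kA ≤ kB) (hV : V.card = n) (hn : 1 ≤ n)
    (hq0 : 0 ≤ q) (hc0 : 0 ≤ c) (hq : q ≤ c * (n : ℝ) ^ (β - 1)) {N k : ℕ} (hNk : β * N = k)
    (hc : (2 * kB * ((N : ℝ) + 2) ^ kB) ^ k * c ^ N * N ≤ 1 / 2) (𝓕 : Finset (Finset ℤ × ℤ))
    (i : ℕ) :
    familyWeight q ((localStep (IsSolutionEdge A B) V N k)^[i] 𝓕) ≤
      (1 / 2) ^ i * familyWeight q 𝓕 := by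
  induction i with
  | zero => simp
  | succ i ih =>
    rw [Function.iterate_succ_apply', pow_succ']
    refine (familyWeight_localStep_le hAB hV hn hq0 hc0 hq hNk hc _).trans ?_
    rw [mul_assoc]
    exact mul_le_mul_of_nonneg_left ih (by norm_num)

/-- The weight of the family of all explorations of a given shape. -/
lemma familyWeight_explorations_le (hAB : kA ≤ kB) (hB : 1 ≤ kB) (hV : V.card = n) (hn : 1 ≤ n)
    (hq0 : 0 ≤ q) (hc0 : 0 ≤ c) (hc1 : c ≤ 1) (hq : q ≤ c * (n : ℝ) ^ (β - 1)) {N₀ k₀ : ℕ}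
    (hNk : β * N₀ = k₀) (hc : (2 * kB * ((N₀ : ℝ) + 2) ^ kB) ^ k₀ * c ^ N₀ * N₀ ≤ 1 / 2)
    {D L N₁ k₁ i N₂ k₂ j N₃ k₃ : ℕ} (hN₁ : N₁ ≤ D) (hk₁ : k₁ ≤ D) (hi : i ≤ L) (hN₂ : N₂ ≤ D)
    (hk₂ : k₂ ≤ D) (hj : j ≤ L) (hN₃ : N₃ ≤ D) (hk₃ : k₃ ≤ D) {M : ℕ}
    (hM : 3 * D + 2 * (L * N₀) ≤ M) :
    familyWeight q (explorations (IsSolutionEdge A B) V N₀ k₀ N₁ k₁ i N₂ k₂ j N₃ k₃) ≤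
      ((2 * kB * ((M : ℝ) + 1) ^ kB) ^ D * (M + 1)) ^ 3 *
        (n : ℝ) ^ ((β * N₁ - k₁) + (β * N₂ - k₂) + (β * N₃ - k₃)) * (1 / 2) ^ (i + j) := by
  have hnpos : (0 : ℝ) < n := by exact_mod_cast hn
  have hiL : i * N₀ ≤ L * N₀ := Nat.mul_le_mul_right _ hi
  have hjL : j * N₀ ≤ L * N₀ := Nat.mul_le_mul_right _ hj
  set E := IsSolutionEdge A B
  set Q := (2 * kB * ((M : ℝ) + 1) ^ kB) ^ D * ((M : ℝ) + 1) with hQ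
  have hQ0 : 0 ≤ Q := by positivity
  have hm0 : ∀ s ∈ ({(∅, default)} : Finset (Finset ℤ × ℤ)), s.1.card ≤ 0 := by simp
  have hm1 := card_le_of_mem_globalStep (E := E) (V := V) (N := N₁) (k := k₁) hm0
  have hm2 := card_le_of_mem_iterate_localStep (E := E) (V := V) (N := N₀) (k := k₀) hm1 i
  have hm3 := card_le_of_mem_globalStep (E := E) (V := V) (N := N₂) (k := k₂) hm2
  have hm4 := card_le_of_mem_iterate_localStep (E := E) (V := V) (N := N₀) (k := k₀) hm3 j
  have hw0 : familyWeight q ({(∅, default)} : Finset (Finset ℤ × ℤ)) = 1 := by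
    simp [familyWeight]
  have hw1 := familyWeight_globalStep_le (A := A) (B := B) hAB hB hV hn hq0 hc0 hc1 hq
    (N := N₁) (M := M) hk₁ (fun s hs => by have := hm0 s hs; omega)
  have hw2 := familyWeight_iterate_localStep_le (A := A) (B := B) hAB hV hn hq0 hc0 hq hNk hc
    (globalStep E V N₁ k₁ {(∅, default)}) i
  have hw3 := familyWeight_globalStep_le (A := A) (B := B) hAB hB hV hn hq0 hc0 hc1 hq
    (N := N₂) (M := M) hk₂ (fun s hs => by have := hm2 s hs; omega)
  have hw4 := familyWeight_iterate_localStep_le (A := A) (B := B) hAB hV hn hq0 hc0 hq hNk hc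
    (globalStep E V N₂ k₂ ((localStep E V N₀ k₀)^[i] (globalStep E V N₁ k₁ {(∅, default)}))) j
  have hw5 := familyWeight_globalStep_le (A := A) (B := B) hAB hB hV hn hq0 hc0 hc1 hq
    (N := N₃) (M := M) hk₃ (fun s hs => by have := hm4 s hs; omega)
  rw [hw0, mul_one] at hw1
  calc _ ≤ Q * (n : ℝ) ^ (β * N₃ - k₃) * ((1 / 2) ^ j * (Q * (n : ℝ) ^ (β * N₂ - k₂) *
        ((1 / 2) ^ i * (Q * (n : ℝ) ^ (β * N₁ - k₁))))) := by
        refine hw5.trans (mul_le_mul_of_nonneg_left (hw4.trans (mul_le_mul_of_nonneg_left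
          (hw3.trans (mul_le_mul_of_nonneg_left (hw2.trans (mul_le_mul_of_nonneg_left hw1 ?_)) ?_))
          ?_)) ?_) <;> positivity
    _ = _ := by
        rw [Real.rpow_add hnpos, Real.rpow_add hnpos, pow_add]
        ring

end Weights

/-! ### Rado sets have rare explorations -/

section Rado

variable {kA kB : ℕ} {A : LinearEquation kA} {B : LinearEquation kB}

lemma IsRado.exists_minimalUncolourable {S : Finset ℤ} (h : IsRado A B (S : Set ℤ)) :
    ∃ FA FB : Finset (Finset ℤ), IsMinimalUncolourable FA FB ∧
      (∀ e ∈ FA, e ⊆ S ∧ A.IsSolutionSet e) ∧ ∀ f ∈ FB, f ⊆ S ∧ B.IsSolutionSet f := by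
  classical
  have hu : IsUncolourable (S.powerset.filter A.IsSolutionSet)
      (S.powerset.filter B.IsSolutionSet) := by
    intro C
    rcases h fun s => if (s : ℤ) ∈ C then .red else .blue with ⟨x, hx, hc⟩ | ⟨x, hx, hc⟩
    · refine Or.inl ⟨Finset.univ.image fun i => (x i : ℤ), ?_, ?_⟩
      · refine Finset.mem_filter.2 ⟨Finset.mem_powerset.2 fun t ht => ?_, _, hx, rfl⟩
        obtain ⟨i, -, rfl⟩ := Finset.mem_image.1 ht
        exact (x i).2
      · intro t ht
        obtain ⟨i, -, rfl⟩ := Finset.mem_image.1 ht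
        by_contra hC
        have := hc i
        simp [hC] at this
    · refine Or.inr ⟨Finset.univ.image fun i => (x i : ℤ), ?_, ?_⟩
      · refine Finset.mem_filter.2 ⟨Finset.mem_powerset.2 fun t ht => ?_, _, hx, rfl⟩
        obtain ⟨i, -, rfl⟩ := Finset.mem_image.1 ht
        exact (x i).2
      · rw [Finset.disjoint_left]
        intro t ht hC
        obtain ⟨i, -, rfl⟩ := Finset.mem_image.1 ht
        have := hc i
        simp [hC] at this
  obtain ⟨FA, hFA, FB, hFB, hmin⟩ := hu.exists_minimal
  refine ⟨FA, FB, hmin, fun e he => ?_, fun f hf => ?_⟩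
  · have := Finset.mem_filter.1 (hFA he)
    exact ⟨Finset.mem_powerset.1 this.1, this.2⟩
  · have := Finset.mem_filter.1 (hFB hf)
    exact ⟨Finset.mem_powerset.1 this.1, this.2⟩

/-- The bounds `w ≤ 1 / 3` and `β ≤ 4 / 9` are attained at `kA = 3`, `kB = 4`, and `w ≤ β` amounts
to `kA ≤ kB`. -/
lemma IsRado.hasRareExploration (hA : 3 ≤ kA) (hAB : kA ≤ kB) (hB : 4 ≤ kB) {S V : Finset ℤ}
    (hSV : S ⊆ V) (h : IsRado A B (S : Set ℤ)) (L : ℕ) :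
    HasRareExploration (IsSolutionEdge A B) V (kA * (kB - 1)) kB (kB / (kA * ((kB : ℝ) - 1)))
      (1 / ((kB : ℝ) - 1)) (kA * kB) L S := by
  obtain ⟨FA, FB, hmin, hFA, hFB⟩ := h.exists_minimalUncolourable
  have hF : IsCrossing kA kB FA FB := hmin.isCrossing (fun e he => (hFA e he).2.card_eq)
    fun f hf => (hFB f hf).2.card_eq
  have hne : FA.Nonempty := hmin.nonempty_left fun f hf =>
    Finset.card_pos.1 (by rw [(hFB f hf).2.card_eq]; omega)
  have hAr : (3 : ℝ) ≤ kA := by exact_mod_cast hA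
  have hBr : (4 : ℝ) ≤ kB := by exact_mod_cast hB
  have hABr : (kA : ℝ) ≤ kB := by exact_mod_cast hAB
  have hb1 : (0 : ℝ) < kB - 1 := by linarith
  have ha0 : (0 : ℝ) < kA := by linarith
  refine hF.hasRareExploration hne (fun e he => Or.inl (hFA e he).2)
    (fun f hf => Or.inr (hFB f hf).2) (fun e he => (hFA e he).1) (fun f hf => (hFB f hf).1) hSV
    (by omega) (by omega) ?_ ?_ ?_ ?_ ?_ ?_
  · field_simp
    ring
  · field_simp
  · positivity
  · rw [div_le_div_iff₀ hb1 (by norm_num)]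
    linarith
  · rw [div_le_div_iff₀ (by positivity) (by norm_num)]
    nlinarith
  · rw [div_le_div_iff₀ hb1 (by positivity)]
    nlinarith

/-- The two hypergraphs are merged into one system of triples, where only the existence of a
monochromatic triple is remembered. -/
lemma IsRado.hasRareExploration_three {A B : LinearEquation 3} {S V : Finset ℤ}
    (hSV : S ⊆ V) (h : IsRado A B (S : Set ℤ)) (L : ℕ) :
    HasRareExploration (IsSolutionEdge A B) V 2 1 (1 / 2) (1 / 2) 6 L S := by
  obtain ⟨FA, FB, hmin, hFA, hFB⟩ := h.exists_minimalUncolourable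
  have hF : IsCrossing 3 3 FA FB := hmin.isCrossing (fun e he => (hFA e he).2.card_eq)
    fun f hf => (hFB f hf).2.card_eq
  have hne : FA.Nonempty := hmin.nonempty_left fun f hf =>
    Finset.card_pos.1 (by rw [(hFB f hf).2.card_eq]; omega)
  refine hasRareExploration_of_triples (G := FA ∪ FB) (hne.mono Finset.subset_union_left) ?_ ?_ ?_
    ?_ (fun Z hZ hin C => hmin.exists_mono_of_closed hZ hin C) hSV le_rfl
  · intro g hg
    exact (Finset.mem_union.1 hg).elim (hF.card_left g) (hF.card_right g)
  · intro g hg x hx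
    rcases Finset.mem_union.1 hg with hg | hg
    · obtain ⟨f, hf, h⟩ := hF.cross_left g hg x hx
      exact ⟨f, Finset.mem_union_right _ hf, h⟩
    · obtain ⟨e, he, h⟩ := hF.cross_right g hg x hx
      exact ⟨e, Finset.mem_union_left _ he, by rwa [Finset.inter_comm]⟩
  · intro g hg
    exact (Finset.mem_union.1 hg).imp (fun h => (hFA g h).2) fun h => (hFB g h).2
  · intro g hg
    exact (Finset.mem_union.1 hg).elim (fun h => (hFA g h).1) fun h => (hFB g h).1

end Rado

/-! ### The union bound -/

section UnionBound

open MeasureTheory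

/-- The probability is a product over `W`, with factor `p` at the points of `u` and `0` elsewhere.
-/
lemma setBernoulli_superset_le {ι : Type*} (u : Set ι) (p : unitInterval) (W : Finset ι) :
    setBernoulli u p {S : Set ι | (W : Set ι) ⊆ S} ≤ ENNReal.ofReal ((p : ℝ) ^ W.card) := by
  have h1 : setBernoulli u p {S : Set ι | (W : Set ι) ⊆ S} =
      ∏ i ∈ W, (unitInterval.toNNReal p • Measure.dirac (i ∈ u) +
        unitInterval.toNNReal (unitInterval.symm p) • Measure.dirac False) {True} := by
    rw [setBernoulli_apply', ← Measure.infinitePi_pi _ (fun i _ => MeasurableSet.singleton _)]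
    congr 1
    ext s
    simp [Set.subset_def]
  rw [h1, ENNReal.ofReal_pow p.2.1, ← Finset.prod_const]
  refine Finset.prod_le_prod' fun i _ => ?_
  have h2 : ((unitInterval.toNNReal p : NNReal) : ENNReal) = ENNReal.ofReal (p : ℝ) := by
    rw [← ENNReal.ofReal_coe_nnreal]; rfl
  simp only [Measure.add_apply, Measure.smul_apply, ENNReal.smul_def, smul_eq_mul]
  rw [Measure.dirac_apply' _ (MeasurableSet.singleton _),
    Measure.dirac_apply' _ (MeasurableSet.singleton _), h2]
  have h3 : Set.indicator {True} (1 : Prop → ENNReal) False = 0 := by simp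
  rw [h3, mul_zero, add_zero]
  calc _ ≤ ENNReal.ofReal (p : ℝ) * 1 := by
        gcongr
        exact Set.indicator_le_self' (by simp) _
    _ = _ := mul_one _

lemma exists_neg_gap (s : Finset ℝ) : ∃ ε > 0, ∀ x ∈ s, x < 0 → x ≤ -ε := by
  induction s using Finset.induction_on with
  | empty => exact ⟨1, one_pos, by simp⟩
  | insert y s _ ih =>
    obtain ⟨ε, hε, h⟩ := ih
    by_cases hy : y < 0
    · refine ⟨min ε (-y), lt_min hε (by linarith), fun x hx hx0 => ?_⟩
      rcases Finset.mem_insert.1 hx with rfl | hx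
      · linarith [min_le_right ε (-x)]
      · linarith [h x hx hx0, min_le_left ε (-y)]
    · refine ⟨ε, hε, fun x hx hx0 => ?_⟩
      rcases Finset.mem_insert.1 hx with rfl | hx
      · exact absurd hx0 hy
      · exact h x hx hx0

variable {kA kB : ℕ} {A : LinearEquation kA} {B : LinearEquation kB}

/-- The shapes of the rare explorations are finite in number, so that their exponents are bounded
away from zero. -/
lemma exists_exponent_gap (β : ℝ) {w : ℝ} (hw : w < 1) (D : ℕ) :
    ∃ ε > 0, ε ≤ 1 - w ∧ ∀ N₁ ≤ D, ∀ k₁ ≤ D, ∀ N₂ ≤ D, ∀ k₂ ≤ D, ∀ N₃ ≤ D, ∀ k₃ ≤ D,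
      (β * (N₁ : ℕ) - (k₁ : ℕ)) + (β * (N₂ : ℕ) - (k₂ : ℕ)) + (β * (N₃ : ℕ) - (k₃ : ℕ)) < 0 →
      (β * N₁ - k₁) + (β * N₂ - k₂) + (β * N₃ - k₃) ≤ -ε := by
  let r := Finset.range (D + 1)
  obtain ⟨ε, hε, h⟩ := exists_neg_gap ((r ×ˢ r ×ˢ r ×ˢ r ×ˢ r ×ˢ r).image fun x =>
    (β * x.1 - x.2.1) + (β * x.2.2.1 - x.2.2.2.1) + (β * x.2.2.2.2.1 - x.2.2.2.2.2))
  refine ⟨min ε (1 - w), lt_min hε (by linarith), min_le_right _ _, ?_⟩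
  intro N₁ hN₁ k₁ hk₁ N₂ hN₂ k₂ hk₂ N₃ hN₃ k₃ hk₃ hneg
  have hr : ∀ m, m ≤ D → m ∈ r := fun m hm => Finset.mem_range.2 (by omega)
  have := h _ (Finset.mem_image.2 ⟨(N₁, k₁, N₂, k₂, N₃, k₃), by
    simp only [Finset.mem_product]
    exact ⟨hr _ hN₁, hr _ hk₁, hr _ hN₂, hr _ hk₂, hr _ hN₃, hr _ hk₃⟩, rfl⟩) hneg
  linarith [min_le_left ε (1 - w)]

/-- A union bound over all rare explorations. -/
lemma measure_isRado_le (hAB : kA ≤ kB) (hB : 1 ≤ kB) {β w ε c : ℝ} {N₀ k₀ D n : ℕ}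
    (hNk : β * N₀ = k₀) (hc0 : 0 ≤ c) (hc1 : c ≤ 1)
    (hc : (2 * kB * ((N₀ : ℝ) + 2) ^ kB) ^ k₀ * c ^ N₀ * N₀ ≤ 1 / 2)
    (hεw : ε ≤ 1 - w)
    (hε : ∀ N₁ ≤ D, ∀ k₁ ≤ D, ∀ N₂ ≤ D, ∀ k₂ ≤ D, ∀ N₃ ≤ D, ∀ k₃ ≤ D,
      (β * (N₁ : ℕ) - (k₁ : ℕ)) + (β * (N₂ : ℕ) - (k₂ : ℕ)) + (β * (N₃ : ℕ) - (k₃ : ℕ)) < 0 →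
      (β * N₁ - k₁) + (β * N₂ - k₂) + (β * N₃ - k₃) ≤ -ε)
    (hrare : ∀ S ⊆ Finset.Icc (1 : ℤ) n, IsRado A B (S : Set ℤ) →
      HasRareExploration (IsSolutionEdge A B) (Finset.Icc (1 : ℤ) n) N₀ k₀ β w D
        (Nat.log 2 n + 1) S)
    (hn : 1 ≤ n) (p : unitInterval) (hp : (p : ℝ) ≤ c * (n : ℝ) ^ (β - 1)) {M : ℕ}
    (hM : 3 * D + 2 * ((Nat.log 2 n + 1) * N₀) ≤ M) :
    randomSubset n p {S : Set ℤ | IsRado A B S} ≤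
      ENNReal.ofReal (((D : ℝ) + 1) ^ 6 * ((Nat.log 2 n : ℝ) + 2) ^ 2 *
        (((2 * kB * ((M : ℝ) + 1) ^ kB) ^ D * (M + 1)) ^ 3 * (n : ℝ) ^ (-ε))) := by
  classical
  have hn1 : (1 : ℝ) ≤ n := by exact_mod_cast hn
  have hnpos : (0 : ℝ) < n := by linarith
  set V := Finset.Icc (1 : ℤ) n with hV
  have hVcard : V.card = n := by simp [hV]
  set L := Nat.log 2 n + 1 with hL
  set Q := ((2 * kB * ((M : ℝ) + 1) ^ kB) ^ D * ((M : ℝ) + 1)) ^ 3 with hQ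
  have hQ0 : 0 ≤ Q := by positivity
  let r := Finset.range (D + 1)
  let l := Finset.range (L + 1)
  let h : ℕ × ℕ × ℕ × ℕ × ℕ × ℕ × ℕ × ℕ → ℝ := fun x =>
    (β * x.1 - x.2.1) + (β * x.2.2.1 - x.2.2.2.1) + (β * x.2.2.2.2.1 - x.2.2.2.2.2.1)
  let I := (r ×ˢ r ×ˢ r ×ˢ r ×ˢ r ×ˢ r ×ˢ l ×ˢ l).filter fun x =>
    h x < 0 ∨ h x ≤ w ∧ L ≤ x.2.2.2.2.2.2.1 + x.2.2.2.2.2.2.2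
  let 𝓔 : ℕ × ℕ × ℕ × ℕ × ℕ × ℕ × ℕ × ℕ → Finset (Finset ℤ × ℤ) := fun x =>
    explorations (IsSolutionEdge A B) V N₀ k₀ x.1 x.2.1 x.2.2.2.2.2.2.1 x.2.2.1 x.2.2.2.1
      x.2.2.2.2.2.2.2 x.2.2.2.2.1 x.2.2.2.2.2.1
  have hIcard : (I.card : ℝ) ≤ ((D : ℝ) + 1) ^ 6 * ((Nat.log 2 n : ℝ) + 2) ^ 2 := by
    have h1 : I.card ≤ (D + 1) ^ 6 * (Nat.log 2 n + 2) ^ 2 := by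
      refine (Finset.card_filter_le _ _).trans (le_of_eq ?_)
      simp only [Finset.card_product, r, l, Finset.card_range, hL]
      ring
    exact_mod_cast h1
  have hweight : ∀ x ∈ I, familyWeight p (𝓔 x) ≤ Q * (n : ℝ) ^ (-ε) := by
    rintro ⟨N₁, k₁, N₂, k₂, N₃, k₃, i, j⟩ hx
    simp only [I, r, l, Finset.mem_filter, Finset.mem_product, Finset.mem_range,
      Nat.lt_succ_iff] at hx
    obtain ⟨⟨hN₁, hk₁, hN₂, hk₂, hN₃, hk₃, hi, hj⟩, hcond⟩ := hx
    refine (familyWeight_explorations_le hAB hB hVcard hn p.2.1 hc0 hc1 hp hNk hc hN₁ hk₁ hi hN₂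
      hk₂ hj hN₃ hk₃ hM).trans ?_
    rw [← hQ, mul_assoc]
    refine mul_le_mul_of_nonneg_left ?_ hQ0
    rcases hcond with hneg | ⟨hle, hij⟩
    · calc _ ≤ (n : ℝ) ^ (-ε) * 1 := by
            refine mul_le_mul ?_ (pow_le_one₀ (by norm_num) (by norm_num)) (by positivity)
              (by positivity)
            exact Real.rpow_le_rpow_of_exponent_le hn1
              (hε N₁ hN₁ k₁ hk₁ N₂ hN₂ k₂ hk₂ N₃ hN₃ k₃ hk₃ hneg)
        _ = _ := mul_one _
    -- The length `L = Nat.log 2 n + 1` is chosen so that `n < 2 ^ L`. The result is `n ^ (w - 1)`,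
    -- which `ε ≤ 1 - w` absorbs.
    · have h2 : ((1 : ℝ) / 2) ^ (i + j) ≤ (n : ℝ) ^ (-1 : ℝ) := by
        calc ((1 : ℝ) / 2) ^ (i + j) ≤ (1 / 2) ^ L :=
              pow_le_pow_of_le_one (by norm_num) (by norm_num) hij
          _ = ((2 : ℝ) ^ L)⁻¹ := by rw [one_div, inv_pow]
          _ ≤ (n : ℝ)⁻¹ := by
              refine inv_anti₀ hnpos ?_
              exact_mod_cast (Nat.lt_pow_succ_log_self (by norm_num) n).le
          _ = _ := (Real.rpow_neg_one _).symm
      calc _ ≤ (n : ℝ) ^ w * (n : ℝ) ^ (-1 : ℝ) := by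
            refine mul_le_mul ?_ h2 (by positivity) (by positivity)
            exact Real.rpow_le_rpow_of_exponent_le hn1 hle
        _ = (n : ℝ) ^ (w + -1) := (Real.rpow_add hnpos _ _).symm
        _ ≤ _ := Real.rpow_le_rpow_of_exponent_le hn1 (by linarith)
  have hsub : {S : Set ℤ | S ∈ {S : Set ℤ | IsRado A B S} ∧ S ⊆ Set.Icc (1 : ℤ) n} ⊆
      ⋃ x ∈ I, ⋃ s ∈ 𝓔 x, {S : Set ℤ | (s.1 : Set ℤ) ⊆ S} := by
    rintro S ⟨hS, hSn⟩
    have hfin : S.Finite := (Set.finite_Icc _ _).subset hSn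
    lift S to Finset ℤ using hfin
    have hSV : S ⊆ V := fun t ht => Finset.mem_Icc.2 (hSn ht)
    obtain ⟨N₁, hN₁, k₁, hk₁, N₂, hN₂, k₂, hk₂, N₃, hN₃, k₃, hk₃, i, hi, j, hj, hcond, s, hs, hsS⟩ :=
      hrare S hSV hS
    simp only [Set.mem_iUnion]
    refine ⟨(N₁, k₁, N₂, k₂, N₃, k₃, i, j), ?_, s, hs, ?_⟩
    · simp only [I, r, l, Finset.mem_filter, Finset.mem_product, Finset.mem_range, Nat.lt_succ_iff]
      exact ⟨⟨hN₁, hk₁, hN₂, hk₂, hN₃, hk₃, hi, hj⟩, hcond⟩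
    · exact Finset.coe_subset.2 hsS
  rw [randomSubset, setBernoulli_apply_eq_apply_subsets]
  calc _ ≤ ∑ x ∈ I, ∑ s ∈ 𝓔 x, setBernoulli (Set.Icc (1 : ℤ) n) p
        {S : Set ℤ | (s.1 : Set ℤ) ⊆ S} :=
        (measure_mono hsub).trans ((measure_biUnion_finset_le _ _).trans
          (Finset.sum_le_sum fun x _ => measure_biUnion_finset_le _ _))
    _ ≤ ∑ x ∈ I, ENNReal.ofReal (Q * (n : ℝ) ^ (-ε)) := by
        refine Finset.sum_le_sum fun x hx => ?_
        refine (Finset.sum_le_sum fun s _ => setBernoulli_superset_le _ _ _).trans ?_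
        rw [← ENNReal.ofReal_sum_of_nonneg fun s _ => pow_nonneg p.2.1 _]
        exact ENNReal.ofReal_le_ofReal (hweight x hx)
    _ = ENNReal.ofReal (I.card * (Q * (n : ℝ) ^ (-ε))) := by
        rw [Finset.sum_const, nsmul_eq_mul, ENNReal.ofReal_mul (Nat.cast_nonneg _),
          ENNReal.ofReal_natCast]
    _ ≤ _ := by
        refine ENNReal.ofReal_le_ofReal (mul_le_mul_of_nonneg_right hIcard ?_)
        positivity

lemma tendsto_natLog_pow_mul_rpow_neg (C : ℝ) (m : ℕ) {ε : ℝ} (hε : 0 < ε) :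
    Tendsto (fun n : ℕ => C * ((Nat.log 2 n : ℝ) + 2) ^ m * (n : ℝ) ^ (-ε)) atTop (𝓝 0) := by
  have h1 : Tendsto (fun x : ℝ => Real.log x ^ m * x ^ (-ε)) atTop (𝓝 0) := by
    have := (isLittleO_log_rpow_rpow_atTop (m : ℝ) hε).tendsto_div_nhds_zero
    refine this.congr' ?_
    filter_upwards [eventually_ge_atTop 1] with x hx
    rw [Real.rpow_natCast, Real.rpow_neg (by linarith), div_eq_mul_inv]
  have h2 := (h1.comp tendsto_natCast_atTop_atTop).const_mul (|C| * 4 ^ m)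
  rw [mul_zero] at h2
  refine squeeze_zero_norm' ?_ h2
  filter_upwards [eventually_ge_atTop 3] with n hn
  have hn3 : (3 : ℝ) ≤ n := by exact_mod_cast hn
  have hlog1 : 1 ≤ Real.log n := by
    rw [Real.le_log_iff_exp_le (by linarith)]
    exact Real.exp_one_lt_d9.le.trans (by linarith)
  have hlog : (Nat.log 2 n : ℝ) ≤ 2 * Real.log n := by
    have h3 : (Nat.log 2 n : ℝ) * Real.log 2 ≤ Real.log n := by
      rw [← Real.log_pow]
      refine Real.log_le_log (by positivity) ?_
      exact_mod_cast Nat.pow_log_le_self 2 (by omega : n ≠ 0)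
    have h4 := Real.log_two_gt_d9
    nlinarith [(Nat.log 2 n).cast_nonneg (α := ℝ)]
  rw [norm_mul, norm_mul, Real.norm_eq_abs, Real.norm_of_nonneg (by positivity),
    Real.norm_of_nonneg (by positivity)]
  calc |C| * ((Nat.log 2 n : ℝ) + 2) ^ m * (n : ℝ) ^ (-ε)
      ≤ |C| * (4 * Real.log n) ^ m * (n : ℝ) ^ (-ε) := by
        gcongr
        linarith
    _ = _ := by simp only [Function.comp_apply, mul_pow]; ring

/-- If every Rado set has a rare exploration then random sets are unlikely to be Rado. -/
theorem tendsto_randomSubset_isRado (hAB : kA ≤ kB) (hB : 1 ≤ kB) {β w c : ℝ} {N₀ k₀ D : ℕ}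
    (hNk : β * N₀ = k₀) (hw : w < 1) (hc0 : 0 ≤ c) (hc1 : c ≤ 1)
    (hc : (2 * kB * ((N₀ : ℝ) + 2) ^ kB) ^ k₀ * c ^ N₀ * N₀ ≤ 1 / 2)
    (hrare : ∀ S V : Finset ℤ, S ⊆ V → IsRado A B (S : Set ℤ) → ∀ L,
      HasRareExploration (IsSolutionEdge A B) V N₀ k₀ β w D L S)
    (p : ℕ → unitInterval) (hp : ∀ᶠ n : ℕ in atTop, (p n : ℝ) ≤ c * (n : ℝ) ^ (β - 1)) :
    Tendsto (fun n : ℕ => randomSubset n (p n) {S : Set ℤ | IsRado A B S}) atTop (𝓝 0) := by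
  obtain ⟨ε, hε, hεw, hgap⟩ := exists_exponent_gap β hw D
  -- With this `K` one has `M + 1 ≤ K y` for `y = Nat.log 2 n + 2`, so everything but `n ^ (-ε)` is
  -- a constant times a fixed power of `y`.
  set K : ℕ := 3 * D + 2 * N₀ + 1 with hK
  have hlim := ENNReal.tendsto_ofReal (tendsto_natLog_pow_mul_rpow_neg
    (((D : ℝ) + 1) ^ 6 * ((2 * kB * (K : ℝ) ^ kB) ^ D * K) ^ 3) (2 + (kB * D + 1) * 3) hε)
  rw [ENNReal.ofReal_zero] at hlim
  refine tendsto_of_tendsto_of_tendsto_of_le_of_le' tendsto_const_nhds hlim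
    (Eventually.of_forall fun _ => zero_le) ?_
  filter_upwards [hp, eventually_ge_atTop 1] with n hpn hn
  refine (measure_isRado_le (w := w) hAB hB hNk hc0 hc1 hc hεw hgap
    (fun S hS h => hrare S _ hS h _) hn (p n) hpn le_rfl).trans (ENNReal.ofReal_le_ofReal ?_)
  set y : ℝ := (Nat.log 2 n : ℝ) + 2 with hy
  have hM : (((3 * D + 2 * ((Nat.log 2 n + 1) * N₀) : ℕ) : ℝ) + 1) ≤ K * y := by
    have : 3 * D + 2 * ((Nat.log 2 n + 1) * N₀) + 1 ≤ K * (Nat.log 2 n + 2) := by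
      rw [hK]; nlinarith [Nat.zero_le (Nat.log 2 n * D), Nat.zero_le (Nat.log 2 n)]
    rw [hy]
    exact_mod_cast this
  calc _ ≤ ((D : ℝ) + 1) ^ 6 * y ^ 2 *
        (((2 * kB * (K * y) ^ kB) ^ D * (K * y)) ^ 3 * (n : ℝ) ^ (-ε)) := by gcongr
    _ = _ := by
        simp only [mul_pow, pow_add, pow_mul]
        ring

end UnionBound

/-! ### The choice of the constant and the conclusion. -/

lemma exists_density_constant {kB : ℕ} (hB : 1 ≤ kB) {N k : ℕ} (hN : 1 ≤ N) :
    ∃ c : ℝ, 0 < c ∧ c ≤ 1 ∧ (2 * kB * ((N : ℝ) + 2) ^ kB) ^ k * c ^ N * N ≤ 1 / 2 := by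
  have hN1 : (1 : ℝ) ≤ N := by exact_mod_cast hN
  have hB1 : (1 : ℝ) ≤ kB := by exact_mod_cast hB
  set K := (2 * kB * ((N : ℝ) + 2) ^ kB) ^ k
  have hK : 1 ≤ K := by
    refine one_le_pow₀ ?_
    have : (1 : ℝ) ≤ ((N : ℝ) + 2) ^ kB := one_le_pow₀ (by linarith)
    nlinarith
  have hKN : 1 ≤ K * N := one_le_mul_of_one_le_of_one_le hK hN1
  have hc1 : 1 / (2 * (K * N)) ≤ 1 := by
    rw [div_le_one (by positivity)]
    linarith
  refine ⟨1 / (2 * (K * N)), by positivity, hc1, ?_⟩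
  calc K * (1 / (2 * (K * N))) ^ N * N ≤ K * (1 / (2 * (K * N))) * N := by
        gcongr
        exact pow_le_of_le_one (by positivity) hc1 (by omega)
    _ = 1 / 2 := by field_simp

theorem theorem1p5 (kA kB : ℕ) (hA : 3 ≤ kA) (hAB : kA ≤ kB) :
    ∃ c : ℝ, 0 < c ∧
      ∀ (A : LinearEquation kA) (B : LinearEquation kB),
        A.Irredundant → B.Irredundant →
        MatrixIrredundant A.underlyingMatrix → MatrixIrredundant B.underlyingMatrix →
        ∀ p : ℕ → unitInterval,
          (∀ᶠ n : ℕ in atTop,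
            (p n : ℝ) ≤ c * (n : ℝ) ^
              (-(((kA : ℝ) * kB - kA - kB) / ((kA : ℝ) * kB - kA)))) →
          Tendsto (fun n : ℕ => randomSubset n (p n) {S : Set ℤ | IsRado A B S})
            atTop (𝓝 0) := by
  -- The case `kA = kB = 3` uses steps of one triple, with `N = 2`, `k = 1`; all others use crowns,
  -- with `N = kA (kB - 1)`, `k = kB`. In both cases `β N = k`.
  rcases Nat.lt_or_ge kB 4 with hB | hB
  · obtain rfl : kB = 3 := by omega
    obtain rfl : kA = 3 := by omega
    obtain ⟨c, hc0, hc1, hc⟩ := exists_density_constant (kB := 3) (N := 2) (k := 1)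
      (by norm_num) (by norm_num)
    refine ⟨c, hc0, fun A B _ _ _ _ p hp => ?_⟩
    refine tendsto_randomSubset_isRado (β := 1 / 2) (w := 1 / 2) le_rfl (by norm_num)
      (by norm_num) (by norm_num) hc0.le hc1 hc
      (fun S V hSV h L => h.hasRareExploration_three hSV L) p ?_
    filter_upwards [hp] with n hn
    convert hn using 3
    norm_num
  · have hAr : (3 : ℝ) ≤ kA := by exact_mod_cast hA
    have hBr : (4 : ℝ) ≤ kB := by exact_mod_cast hB
    have hb1 : (0 : ℝ) < kB - 1 := by linarith
    have ha0 : (0 : ℝ) < kA := by linarith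
    obtain ⟨c, hc0, hc1, hc⟩ := exists_density_constant (kB := kB) (N := kA * (kB - 1)) (k := kB)
      (by omega) (Nat.mul_pos (by omega) (by omega))
    refine ⟨c, hc0, fun A B _ _ _ _ p hp => ?_⟩
    refine tendsto_randomSubset_isRado (β := kB / (kA * ((kB : ℝ) - 1)))
      (w := 1 / ((kB : ℝ) - 1)) hAB (by omega) ?_ ?_ hc0.le hc1 hc
      (fun S V hSV h L => h.hasRareExploration hA hAB hB hSV L) p ?_
    · rw [Nat.cast_mul, Nat.cast_sub (by omega : 1 ≤ kB), Nat.cast_one]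
      field_simp
    · rw [div_lt_one hb1]
      linarith
    · filter_upwards [hp] with n hn
      convert hn using 3
      have : (kA : ℝ) * kB - kA = kA * (kB - 1) := by ring
      rw [this]
      field_simp
      ring
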